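/- Let $(\Omega,P)$ be a probability space. A fractional Brownian motion (fBm) with Hurst parameter $H\in(0,1)$ is a centered Gaussian process $B=(B_t)_{t\ge 0}$ with $\mathbb{E}[B_tB_s]=\frac12\left(t^{2H}+s^{2H}-|t-s|^{2H}\right)$. Let $B^1,\dots,B^r$ be processes indexed by $[0,\infty)$, each of which is either an fBm with some Hurst parameter $H_j\in(1/2,1)$ or the identity function $B^j_t=t$. Assume that any two of them are either equal or independent, and that, more precisely, the distinct processes among $B^1,\dots,B^r$ are mutually independent as a family. Let $T>0$. For processes $f,g$ on $[0,T]$, the Riemann–Stieltjes integral $\int_0^T f\,dg$ is understood in the sense of $L_p$-convergence for all $p\in[1,\infty)$: it is a random variable $Y$ belonging to $L_p$ for all $p\in[1,\infty)$ such that, for each such $p$, the sums $\sum_i f_{\xi_i}(g_{x_{i+1}}-g_{x_i})$ converge to $Y$ in $L_p$ as the mesh of the tagged partition ($0=x_0<\dots<x_m=T$, $\xi_i\in[x_i,x_{i+1}]$) tends to $0$. For $\mathcal{A}\subset[0,T]^r$ write $$J_r(\mathcal{A})=\int_0^T\cdots\int_0^T \mathbf 1_{\mathcal{A}}(s_1,\dots,s_r)\,dB^1_{s_1}\cdots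 dB^r_{s_r}$$ for the iterated Riemann–Stieltjes integral (innermost in $s_1$, outermost in $s_r$), whenever it exists, and $\widetilde J_r(\mathcal{A})=J_r(\mathcal{A})-\mathbb{E}[J_r(\mathcal{A})]$. Let $0=t_0<t_1<\dots<t_n=T$ be a partition of $[0,T]$ and put $$\mathcal{A}=\bigcup_{k=0}^{n-1}\{(s_1,\dots,s_r): t_k\le s_1\le\cdots\le s_r\le t_{k+1}\},\qquad \mathcal{A}'=\bigcup_{k=0}^{n-1}[t_k,t_{k+1}]^r .$$ Then $J_r(\mathcal{A})$ and $J_r(\mathcal{A}')$ are well defined (they exist, and are unique up to almost sure equality) and square integrable, and $$\mathbb{E}\left(|J_r(\mathcal{A})|^2\right)\le \mathbb{E}\left(|J_r(\mathcal{A}')|^2\right),\qquad \mathbb{E}\left(|\widetilde J_r(\mathcal{A})|^2\right)\le \mathbb{E}\left(|\widetilde J_r(\mathcal{A}')|^2\right).$$ -/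

import Mathlib

open MeasureTheory ProbabilityTheory
open scoped NNReal ENNReal

/-- `B` is a standard one-dimensional fractional Brownian motion with Hurst parameter `H ∈ (0,1)`
on the probability space `(Ω, P)`: a centered Gaussian process indexed by `[0, ∞)` with covariance
`E[B_t B_s] = (t^{2H} + s^{2H} - |t - s|^{2H}) / 2`. -/
structure IsFBM {Ω : Type*} [MeasurableSpace Ω] (P : Measure Ω) (H : ℝ)
    (B : ℝ≥0 → Ω → ℝ) : Prop where
  hurst_pos : 0 < H
  hurst_lt_one : H < 1
  measurable : ∀ t, Measurable (B t)
  gaussian : IsGaussianProcess B P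
  centered : ∀ t, ∫ ω, B t ω ∂P = 0
  covariance : ∀ t s : ℝ≥0, ∫ ω, B t ω * B s ω ∂P
    = 1 / 2 * ((t : ℝ) ^ (2 * H) + (s : ℝ) ^ (2 * H) - |(t : ℝ) - (s : ℝ)| ^ (2 * H))

/-- The identity function `t ↦ t`, seen as a (deterministic) process. -/
def identityProcess (Ω : Type*) : ℝ≥0 → Ω → ℝ := fun t _ => (t : ℝ)

/-- A tagged partition `0 = x_0 < x_1 < ⋯ < x_m = T` of `[0,T]`, with a tag in each
`[x_i, x_{i+1}]`. -/
structure TaggedPartition (T : ℝ≥0) where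
  m : ℕ
  pt : Fin (m + 1) → ℝ≥0
  strictMono : StrictMono pt
  pt_zero : pt 0 = 0
  pt_last : pt (Fin.last m) = T
  tag : Fin m → ℝ≥0
  tag_mem : ∀ i : Fin m, tag i ∈ Set.Icc (pt i.castSucc) (pt i.succ)

/-- All intervals of the partition are shorter than `δ`. -/
def TaggedPartition.MeshLT {T : ℝ≥0} (π : TaggedPartition T) (δ : ℝ) : Prop :=
  ∀ i : Fin π.m, (π.pt i.succ : ℝ) - (π.pt i.castSucc : ℝ) < δ

/-- The Riemann-Stieltjes sum of `f` against `g` along a tagged partition. -/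
noncomputable def TaggedPartition.rsSum {Ω : Type*} {T : ℝ≥0} (π : TaggedPartition T)
    (f g : ℝ≥0 → Ω → ℝ) (ω : Ω) : ℝ :=
  ∑ i : Fin π.m, f (π.tag i) ω * (g (π.pt i.succ) ω - g (π.pt i.castSucc) ω)

/-- The random variable `Y` is (a version of) the Riemann-Stieltjes integral `∫_0^T f dg`,
in the sense of `L_p`-convergence for every `p ∈ [1, ∞)`: `Y ∈ L_p`, and the Riemann-Stieltjes sums
converge to `Y` in `L_p` as the mesh of the tagged partition tends to zero. -/
def HasRSIntegral {Ω : Type*} [MeasurableSpace Ω] (P : Measure Ω) (T : ℝ≥0)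
    (f g : ℝ≥0 → Ω → ℝ) (Y : Ω → ℝ) : Prop :=
  ∀ p : ℝ≥0∞, 1 ≤ p → p ≠ ∞ →
    MemLp Y p P ∧
    ∀ ε : ℝ≥0∞, 0 < ε → ∃ δ : ℝ, 0 < δ ∧ ∀ π : TaggedPartition T, π.MeshLT δ →
      eLpNorm (fun ω => π.rsSum f g ω - Y ω) p P < ε

open Classical in
/-- The random variable `J` is (a version of) the multiple integral
`J_r(A) = ∫_0^T ⋯ ∫_0^T 1_A(s_1, …, s_r) dB^1_{s_1} ⋯ dB^r_{s_r}`, as an iterated Riemann-Stieltjes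
integral. The outermost integral is the one in `s_r`: its integrand at `s_r = s` is the
`(r-1)`-fold integral, against `B^1, …, B^{r-1}`, of the indicator of the section of `A` at
`s_r = s`. The `0`-fold integral is the value of the indicator at the only point. -/
def HasMultipleIntegral {Ω : Type*} [MeasurableSpace Ω] (P : Measure Ω) (T : ℝ≥0) :
    (r : ℕ) → (Fin r → ℝ≥0 → Ω → ℝ) → Set (Fin r → ℝ≥0) → (Ω → ℝ) → Prop
  | 0, _, A, J => J =ᵐ[P] fun _ => if (Fin.elim0 : Fin 0 → ℝ≥0) ∈ A then (1 : ℝ) else 0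
  | r + 1, B, A, J => ∃ F : ℝ≥0 → Ω → ℝ,
      (∀ s ∈ Set.Icc 0 T, HasMultipleIntegral P T r (fun j => B j.castSucc)
        {x : Fin r → ℝ≥0 | (Fin.snoc x s : Fin (r + 1) → ℝ≥0) ∈ A} (F s)) ∧
      HasRSIntegral P T F (B (Fin.last r)) J

/-- `J_r(A)` is well defined: the iterated integral exists, and it is unique almost surely. -/
def MultipleIntegralWellDefined {Ω : Type*} [MeasurableSpace Ω] (P : Measure Ω) (T : ℝ≥0)
    (r : ℕ) (B : Fin r → ℝ≥0 → Ω → ℝ) (A : Set (Fin r → ℝ≥0)) : Prop :=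
  (∃ J, HasMultipleIntegral P T r B A J) ∧
    ∀ J₁ J₂, HasMultipleIntegral P T r B A J₁ → HasMultipleIntegral P T r B A J₂ → J₁ =ᵐ[P] J₂

/-- `[s,t]^r = {(s_1, …, s_r) : s ≤ s_i ≤ t for all i}`. -/
def cube (r : ℕ) (s t : ℝ≥0) : Set (Fin r → ℝ≥0) :=
  {x | ∀ i, x i ∈ Set.Icc s t}

/-- `[s,t]^r_< = {(s_1, …, s_r) : s ≤ s_1 ≤ ⋯ ≤ s_r ≤ t}`. -/
def orderedSimplex (r : ℕ) (s t : ℝ≥0) : Set (Fin r → ℝ≥0) :=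
  {x | Monotone x ∧ ∀ i, x i ∈ Set.Icc s t}

/-!
Both inequalities follow from a comparison in an ordered algebra of random variables; no explicit
formula for the two multiple integrals is needed.

*Positivity.* All increments `B^j_v - B^j_u`, `u ≤ v`, form one jointly Gaussian family with
nonnegative means and nonnegative covariances: the covariance of two increments of a fractional
Brownian motion with `H > 1/2` is nonnegative since `x ↦ |x|^{2H}` is convex. Gaussian integration
by parts (`IsGaussianProcess.integral_mul_prod`) then shows, by induction on the number of factors,
that products `X`, `Y` of such increments satisfy `0 ≤ E[X] E[Y] ≤ E[X Y]`. By bilinearity and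
continuity this extends to the closed cone `momentCone` of all `L_p`-limits, for every `p < ∞`, of
sums of products of increments. Hence if `X` and `Y - X` lie in the cone, then
`E[Y²] - E[X²] = E[(Y - X) (Y + X)] ≥ 0`, and likewise for variances
(`integral_sq_le_of_mem_momentCone`).

*Monotonicity.* A Riemann–Stieltjes sum multiplies values of the integrand by increments of the
integrator, so integration maps the cone to itself. By induction on `r`, whenever `A ⊆ A'` and both
multiple integrals exist, `J_r(A)` and `J_r(A') - J_r(A)` lie in the cone
(`HasMultipleIntegral.sub_mem_momentCone`). The union of simplices is contained in the union of
cubes.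

*Existence.* The integrators are Hölder continuous in every `L_p` with an exponent above `1/2`, so
Young's theory applies with values in the Banach spaces `L_p`: the sewing lemma
(`AlmostAdditive.exists_path`) gives indefinite integrals that are again Hölder continuous with an
exponent above `1/2` (`exists_young_integral`). Iterating, the integrals over a single simplex or
cube exist. Since consecutive simplices (cubes) meet in one corner, inclusion–exclusion gives the
integral over their union (`exists_hasMultipleIntegral_iUnion`).
-/

/-! ### Random variables with finite moments of all orders -/

/-- `X` has finite absolute moments of all orders, that is, `X` lies in `L_p` for every `p < ∞`. -/
def HasAllMoments {Ω : Type*} [MeasurableSpace Ω] (P : Measure Ω) (X : Ω → ℝ) : Prop :=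
  ∀ p : ℝ≥0∞, p ≠ ∞ → MemLp X p P

/-- The exponent relation behind the Cauchy–Schwarz type bound `‖XY‖_p ≤ ‖X‖_{2p} ‖Y‖_{2p}`. -/
lemma holderTriple_two_mul (p : ℝ≥0∞) : ENNReal.HolderTriple (2 * p) (2 * p) p where
  inv_add_inv_eq_inv := by
    rw [ENNReal.mul_inv (by simp) (by simp), ← add_mul, ENNReal.inv_two_add_inv_two, one_mul]

namespace HasAllMoments

variable {Ω : Type*} [MeasurableSpace Ω] {P : Measure Ω} {X Y : Ω → ℝ}

lemma of_one_le [IsProbabilityMeasure P] (h : ∀ p : ℝ≥0∞, 1 ≤ p → p ≠ ∞ → MemLp X p P) :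
    HasAllMoments P X := fun p hp =>
  (h (max p 1) (le_max_right _ _) (by simp [hp])).mono_exponent (le_max_left _ _)

lemma mul (hX : HasAllMoments P X) (hY : HasAllMoments P Y) :
    HasAllMoments P (fun ω => X ω * Y ω) := fun p hp =>
  have := holderTriple_two_mul p
  have h2 : 2 * p ≠ ∞ := ENNReal.mul_ne_top (by simp) hp
  (hY _ h2).mul (hX _ h2)

lemma add (hX : HasAllMoments P X) (hY : HasAllMoments P Y) :
    HasAllMoments P (fun ω => X ω + Y ω) := fun p hp => (hX p hp).add (hY p hp)

lemma sub (hX : HasAllMoments P X) (hY : HasAllMoments P Y) :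
    HasAllMoments P (fun ω => X ω - Y ω) := fun p hp => (hX p hp).sub (hY p hp)

lemma const [IsProbabilityMeasure P] (c : ℝ) : HasAllMoments P (fun _ => c) :=
  fun _ _ => memLp_const c

lemma const_mul (hX : HasAllMoments P X) (c : ℝ) :
    HasAllMoments P (fun ω => c * X ω) := fun p hp => (hX p hp).const_mul c

lemma finset_sum {ι : Type*} {s : Finset ι} {X : ι → Ω → ℝ} (hX : ∀ i ∈ s, HasAllMoments P (X i)) :
    HasAllMoments P (fun ω => ∑ i ∈ s, X i ω) := fun p hp =>
  memLp_finsetSum s fun i hi => hX i hi p hp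

lemma finset_prod [IsProbabilityMeasure P] {ι : Type*} {s : Finset ι} {X : ι → Ω → ℝ}
    (hX : ∀ i ∈ s, HasAllMoments P (X i)) :
    HasAllMoments P (fun ω => ∏ i ∈ s, X i ω) := by
  classical
  induction s using Finset.induction_on with
  | empty => simpa using const 1
  | insert i s hi ih =>
    simp only [Finset.prod_insert hi]
    exact (hX i (by simp)).mul (ih fun j hj => hX j (by simp [hj]))

lemma congr_ae (hX : HasAllMoments P X) (h : X =ᵐ[P] Y) : HasAllMoments P Y :=
  fun p hp => (memLp_congr_ae h).1 (hX p hp)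

lemma integrable [IsProbabilityMeasure P] (hX : HasAllMoments P X) : Integrable X P :=
  memLp_one_iff_integrable.1 (hX 1 (by simp))

lemma memLp_two (hX : HasAllMoments P X) : MemLp X 2 P := hX 2 (by simp)

end HasAllMoments

/-! ### Gaussian integration by parts and correlation inequalities -/

section GaussianIBP

open Polynomial

lemma hasAllMoments_gaussianReal_polynomial (m : ℝ) (v : ℝ≥0) (q : ℝ[X]) :
    HasAllMoments (gaussianReal m v) (fun x => q.eval x) := by
  have hid : HasAllMoments (gaussianReal m v) (fun x => x) := fun p hp =>
    memLp_id_gaussianReal' p hp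
  induction q using Polynomial.induction_on' with
  | add p q hp hq => simpa using hp.add hq
  | monomial n a =>
    simp only [eval_monomial]
    simpa using (HasAllMoments.finset_prod (s := Finset.range n) (X := fun _ x => x)
      fun _ _ => hid).const_mul a

/-- Gaussian integration by parts (Stein's identity) in one dimension, for polynomials. -/
lemma integral_mul_polynomial_gaussianReal (m : ℝ) (v : ℝ≥0) (q : ℝ[X]) :
    ∫ x, x * q.eval x ∂(gaussianReal m v)
      = m * ∫ x, q.eval x ∂(gaussianReal m v)
        + v * ∫ x, q.derivative.eval x ∂(gaussianReal m v) := by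
  by_cases hv : v = 0
  · subst hv
    simp
  have hint : ∀ q : ℝ[X], Integrable (fun x => q.eval x * gaussianPDFReal m v x) := by
    intro q
    have := (hasAllMoments_gaussianReal_polynomial m v q).integrable
    rw [gaussianReal_of_var_ne_zero _ hv, integrable_withDensity_iff (measurable_gaussianPDF _ _)
      (Filter.Eventually.of_forall fun _ => gaussianPDF_lt_top)] at this
    simpa using this
  have hderiv : ∀ x, HasDerivAt (fun x => v * gaussianPDFReal m v x)
      (-(x - m) * gaussianPDFReal m v x) x := by
    intro x
    have h1 : HasDerivAt (fun x : ℝ => -(x - m) ^ 2 / (2 * v)) (-(2 * (x - m)) / (2 * v)) x := by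
      have := ((((hasDerivAt_id x).sub_const m).pow 2).neg).div_const (2 * (v : ℝ))
      simpa using this
    have h2 := ((h1.exp).const_mul ((√(2 * Real.pi * v))⁻¹)).const_mul (v : ℝ)
    refine h2.congr_deriv ?_
    have : (v : ℝ) ≠ 0 := by exact_mod_cast hv
    rw [gaussianPDFReal]
    field_simp
  have key := integral_mul_deriv_eq_deriv_mul_of_integrable
    (u := fun x => q.eval x) (u' := fun x => q.derivative.eval x)
    (v := fun x => v * gaussianPDFReal m v x) (v' := fun x => -(x - m) * gaussianPDFReal m v x)
    (fun x _ => q.hasDerivAt x) (fun x _ => hderiv x)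
    ((hint (q * -(X - C m))).congr (.of_forall fun x => by simp; ring))
    (((hint (derivative q)).const_mul v).congr
      (.of_forall fun x => by simp only [Pi.mul_apply]; ring))
    (((hint q).const_mul v).congr (.of_forall fun x => by simp only [Pi.mul_apply]; ring))
  simp only [integral_gaussianReal_eq_integral_smul hv, smul_eq_mul]
  have e1 : (fun x => q.eval x * (-(x - m) * gaussianPDFReal m v x))
      = fun x => m * (gaussianPDFReal m v x * q.eval x)
        - gaussianPDFReal m v x * (x * q.eval x) := by
    ext x; ring
  have e2 : (fun x => q.derivative.eval x * (v * gaussianPDFReal m v x))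
      = fun x => v * (gaussianPDFReal m v x * q.derivative.eval x) := by
    ext x; ring
  rw [e1, e2, integral_sub, integral_const_mul, integral_const_mul] at key
  · linarith
  · exact ((hint q).const_mul m).congr (.of_forall fun x => by ring)
  · exact (hint (X * q)).congr (.of_forall fun x => by simp; ring)

end GaussianIBP

section GaussianProcess

variable {Ω : Type*} [MeasurableSpace Ω] {P : Measure Ω} {ι : Type*} {X : ι → Ω → ℝ}

lemma ProbabilityTheory.IsGaussianProcess.hasAllMoments (hX : IsGaussianProcess X P) (i : ι) :
    HasAllMoments P (X i) := fun _ hp => (hX.hasGaussianLaw_eval i).memLp hp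

variable [IsProbabilityMeasure P]

/-- Integrating a function of two independent random variables whose partial integral in the first
variable vanishes. -/
lemma integral_comp_eq_zero_of_indepFun {β : Type*} [MeasurableSpace β] {U : Ω → ℝ} {V : Ω → β}
    (hU : AEMeasurable U P) (hV : AEMeasurable V P) (hUV : IndepFun U V P) {h : ℝ × β → ℝ}
    (hh : Measurable h) (hint : Integrable (fun ω => h (U ω, V ω)) P)
    (h0 : ∀ y, ∫ x, h (x, y) ∂(P.map U) = 0) : ∫ ω, h (U ω, V ω) ∂P = 0 := by
  have hm : AEMeasurable (fun ω => (U ω, V ω)) P := hU.prodMk hV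
  have : IsProbabilityMeasure (P.map U) := Measure.isProbabilityMeasure_map hU
  have : IsProbabilityMeasure (P.map V) := Measure.isProbabilityMeasure_map hV
  have hmap := (indepFun_iff_map_prod_eq_prod_map_map hU hV).1 hUV
  have hi : Integrable h (P.map (fun ω => (U ω, V ω))) :=
    (integrable_map_measure hh.aestronglyMeasurable hm).2 hint
  rw [← integral_map hm hh.aestronglyMeasurable, hmap]
  rw [hmap] at hi
  rw [integral_prod_symm _ hi]
  simp [h0]

/-- Gaussian integration by parts for products of jointly Gaussian variables: the recursion behind
the Isserlis–Wick formula. The proof splits each factor as `X i = c i * X i₀ + R i` with `R`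
independent of `X i₀`. -/
lemma ProbabilityTheory.IsGaussianProcess.integral_mul_prod [DecidableEq ι]
    (hX : IsGaussianProcess X P) (i₀ : ι) (s : Finset ι) :
    ∫ ω, X i₀ ω * ∏ i ∈ s, X i ω ∂P
      = (∫ ω, X i₀ ω ∂P) * (∫ ω, ∏ i ∈ s, X i ω ∂P)
        + ∑ i ∈ s, cov[X i₀, X i; P] * ∫ ω, ∏ j ∈ s.erase i, X j ω ∂P := by
  have hmom := hX.hasAllMoments
  set m := ∫ ω, X i₀ ω ∂P with hm
  set v : ℝ≥0 := Var[X i₀; P].toNNReal with hv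
  have hvar : (v : ℝ) = Var[X i₀; P] := Real.coe_toNNReal _ (variance_nonneg _ _)
  have hlaw : P.map (X i₀) = gaussianReal m v := (hX.hasGaussianLaw_eval i₀).map_eq_gaussianReal
  obtain ⟨c, hc⟩ : ∃ c : ι → ℝ, ∀ i, v * c i = cov[X i₀, X i; P] := by
    refine ⟨fun i => cov[X i₀, X i; P] / v, fun i => ?_⟩
    by_cases h0 : (v : ℝ) = 0
    -- the quotient is then `0`, which is right because `X i₀` is almost surely constant
    · have hae : X i₀ =ᵐ[P] fun _ => m := by
        rw [hvar] at h0
        exact ae_eq_integral_of_variance_eq_zero (hmom i₀).memLp_two h0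
      have : cov[X i₀, X i; P] = 0 := by
        rw [covariance]
        refine integral_eq_zero_of_ae ?_
        filter_upwards [hae] with ω hω
        simp [hω, hm]
      simp [this]
    · field_simp
  let R : s → Ω → ℝ := fun i ω => X i ω - c i * X i₀ ω
  have hRg : IsGaussianProcess (Sum.elim (fun _ : Unit => X i₀) R) P := by
    refine hX.of_isGaussianProcess fun k => ?_
    rcases k with k | k
    · exact ⟨{i₀}, ContinuousLinearMap.proj ⟨i₀, by simp⟩, fun ω => by simp⟩
    · refine ⟨{i₀, k.1}, ContinuousLinearMap.proj (R := ℝ) (φ := fun _ => ℝ) ⟨k.1, by simp⟩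
        - c k • ContinuousLinearMap.proj (R := ℝ) (φ := fun _ => ℝ) ⟨i₀, by simp⟩, fun ω => by
          simp [R]⟩
  have hind : IndepFun (X i₀) (fun ω (i : s) => R i ω) P := by
    have := hRg.indepFun_of_covariance_eq_zero (fun _ => (hmom i₀).integrable.aemeasurable)
      (fun t => ((hmom t).sub ((hmom i₀).const_mul (c t))).integrable.aemeasurable) (fun _ t => by
        change cov[X i₀, X t - fun ω => c t * X i₀ ω; P] = 0
        rw [covariance_sub_right (hmom i₀).memLp_two (hmom t).memLp_two
          ((hmom i₀).const_mul (c t)).memLp_two, covariance_const_mul_right,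
          covariance_self (hmom i₀).integrable.aemeasurable, ← hvar, ← hc]
        ring)
    exact this.comp (φ := fun f : Unit → ℝ => f ()) (measurable_pi_apply ()) measurable_id
  have hprod : ∀ t : Finset ι, HasAllMoments P (fun ω => ∏ i ∈ t, X i ω) := fun t =>
    .finset_prod fun i _ => hmom i
  let h : ℝ × (s → ℝ) → ℝ := fun z =>
    z.1 * ∏ i : s, (c i * z.1 + z.2 i) - m * ∏ i : s, (c i * z.1 + z.2 i)
      - v * ∑ i : s, (∏ j ∈ Finset.univ.erase i, (c j * z.1 + z.2 j)) * c i
  have hh : Measurable h := by fun_prop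
  have hcomp : ∀ ω, h (X i₀ ω, fun i => R i ω) = X i₀ ω * ∏ i ∈ s, X i ω - m * ∏ i ∈ s, X i ω
      - ∑ i ∈ s, cov[X i₀, X i; P] * ∏ j ∈ s.erase i, X j ω := by
    intro ω
    have e : ∀ i : s, c i * X i₀ ω + R i ω = X i ω := fun i => by simp [R]
    simp only [h, e, Finset.mul_sum]
    rw [Finset.prod_coe_sort s (fun i => X i ω), ← Finset.sum_coe_sort s]
    congr 1
    refine Finset.sum_congr rfl fun i _ => ?_
    rw [← hc]
    have : ∏ j ∈ Finset.univ.erase i, X j ω = ∏ j ∈ s.erase i, X j ω := by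
      refine Finset.prod_bij (fun j _ => (j : ι)) (fun j hj => ?_)
        (fun a _ b _ hab => Subtype.ext hab)
        (fun b hb => ?_) (fun _ _ => rfl)
      · simp only [Finset.mem_erase, Finset.mem_univ, and_true] at hj
        exact Finset.mem_erase.2 ⟨fun h => hj (Subtype.ext h), j.2⟩
      · obtain ⟨h1, h2⟩ := Finset.mem_erase.1 hb
        exact ⟨⟨b, h2⟩, by simpa [Subtype.ext_iff] using h1, rfl⟩
    rw [this]; ring
  have i1 := ((hmom i₀).mul (hprod s)).integrable
  have i2 := ((hprod s).const_mul m).integrable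
  have i3 : ∀ i ∈ s, Integrable (fun ω => cov[X i₀, X i; P] * ∏ j ∈ s.erase i, X j ω) P :=
    fun i _ => ((hprod _).const_mul _).integrable
  have hzero : ∫ ω, h (X i₀ ω, fun i => R i ω) ∂P = 0 := by
    refine integral_comp_eq_zero_of_indepFun (hmom i₀).integrable.aemeasurable
      (aemeasurable_pi_lambda (fun ω (i : s) => R i ω) fun i =>
        ((hmom i).sub ((hmom i₀).const_mul (c i))).integrable.aemeasurable) hind hh ?_ ?_
    · simp only [hcomp]
      exact (i1.sub i2).sub (integrable_finsetSum _ i3)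
    · intro y
      rw [hlaw]
      let q : Polynomial ℝ := ∏ i : s, (Polynomial.C (c i) * Polynomial.X + Polynomial.C (y i))
      have hq : ∀ x, q.eval x = ∏ i : s, (c i * x + y i) := fun x => by
        simp [q, Polynomial.eval_prod]
      have hq' : ∀ x, q.derivative.eval x
          = ∑ i : s, (∏ j ∈ Finset.univ.erase i, (c j * x + y j)) * c i := fun x => by
        rw [Polynomial.derivative_prod_finset, Polynomial.eval_finsetSum]
        simp [Polynomial.eval_prod]
      have hpoly := hasAllMoments_gaussianReal_polynomial m v
      have hXq := (hpoly (Polynomial.X * q)).integrable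
      simp only [Polynomial.eval_mul, Polynomial.eval_X] at hXq
      simp only [h, ← hq, ← hq']
      rw [integral_sub, integral_sub, integral_const_mul, integral_const_mul,
        integral_mul_polynomial_gaussianReal]
      · ring
      · exact hXq
      · exact ((hpoly q).const_mul m).integrable
      · exact .sub hXq ((hpoly q).const_mul m).integrable
      · exact ((hpoly q.derivative).const_mul v).integrable
  simp only [hcomp] at hzero
  rw [integral_sub (by exact i1.sub i2) (integrable_finsetSum _ i3), integral_sub i1 i2,
    integral_finsetSum _ i3] at hzero
  simp only [integral_const_mul] at hzero
  linarith

/-- Moments of jointly Gaussian variables with nonnegative means and covariances are nonnegative. -/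
lemma ProbabilityTheory.IsGaussianProcess.integral_prod_nonneg (hX : IsGaussianProcess X P)
    (hmean : ∀ i, 0 ≤ ∫ ω, X i ω ∂P) (hcov : ∀ i j, 0 ≤ cov[X i, X j; P]) (s : Finset ι) :
    0 ≤ ∫ ω, ∏ i ∈ s, X i ω ∂P := by
  classical
  induction s using Finset.strongInduction with
  | H s ih =>
    rcases s.eq_empty_or_nonempty with rfl | ⟨i, hi⟩
    · simp
    · simp only [← Finset.mul_prod_erase s _ hi]
      rw [hX.integral_mul_prod]
      have hlt := Finset.erase_ssubset hi
      exact add_nonneg (mul_nonneg (hmean i) (ih _ hlt)) (Finset.sum_nonneg fun j hj =>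
        mul_nonneg (hcov i j) (ih _ ((Finset.erase_subset _ _).trans_ssubset hlt)))

/-- Products of jointly Gaussian variables with nonnegative means and covariances are positively
correlated. -/
lemma ProbabilityTheory.IsGaussianProcess.mul_integral_prod_le (hX : IsGaussianProcess X P)
    (hmean : ∀ i, 0 ≤ ∫ ω, X i ω ∂P) (hcov : ∀ i j, 0 ≤ cov[X i, X j; P]) (s t : Finset ι)
    (hst : Disjoint s t) :
    (∫ ω, ∏ i ∈ s, X i ω ∂P) * (∫ ω, ∏ i ∈ t, X i ω ∂P)
      ≤ ∫ ω, (∏ i ∈ s, X i ω) * ∏ i ∈ t, X i ω ∂P := by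
  classical
  have hnn := hX.integral_prod_nonneg hmean hcov
  induction s using Finset.strongInduction with
  | H s ih =>
    rcases s.eq_empty_or_nonempty with rfl | ⟨i, hi⟩
    · simp
    · have hlt := Finset.erase_ssubset hi
      have hdisj : ∀ u ⊆ s, Disjoint u t := fun u hu => hst.mono_left hu
      have e : ∀ ω, (∏ k ∈ s, X k ω) * ∏ k ∈ t, X k ω
          = X i ω * ∏ k ∈ s.erase i ∪ t, X k ω := fun ω => by
        rw [Finset.prod_union (hdisj _ hlt.subset), ← Finset.mul_prod_erase s _ hi, mul_assoc]
      simp only [e]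
      simp only [← Finset.mul_prod_erase s _ hi]
      rw [hX.integral_mul_prod, hX.integral_mul_prod, Finset.sum_union (hdisj _ hlt.subset),
        add_mul, Finset.sum_mul, ← add_assoc, mul_assoc]
      have h1 := mul_le_mul_of_nonneg_left (ih _ hlt (hdisj _ hlt.subset)) (hmean i)
      have h2 : ∑ j ∈ s.erase i, cov[X i, X j; P] * (∫ ω, ∏ k ∈ (s.erase i).erase j, X k ω ∂P)
            * (∫ ω, ∏ k ∈ t, X k ω ∂P)
          ≤ ∑ j ∈ s.erase i, cov[X i, X j; P] * ∫ ω, ∏ k ∈ (s.erase i ∪ t).erase j, X k ω ∂P := by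
        refine Finset.sum_le_sum fun j hj => ?_
        have hlt' := (Finset.erase_subset j _).trans_ssubset hlt
        have hjt : j ∉ t := Finset.disjoint_left.1 (hdisj _ hlt.subset) hj
        rw [mul_assoc]
        refine mul_le_mul_of_nonneg_left ((ih _ hlt' (hdisj _ hlt'.subset)).trans_eq ?_) (hcov i j)
        rw [Finset.erase_union_distrib, Finset.erase_eq_of_notMem hjt]
        simp only [Finset.prod_union (hdisj _ hlt'.subset)]
      have h3 : 0 ≤ ∑ j ∈ t, cov[X i, X j; P] * ∫ ω, ∏ k ∈ (s.erase i ∪ t).erase j, X k ω ∂P :=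
        Finset.sum_nonneg fun j _ => mul_nonneg (hcov i j) (hnn _)
      simp only [Finset.prod_union (hdisj _ hlt.subset)] at h1 ⊢
      linarith

end GaussianProcess

/-! ### The closed cone generated by products of positively correlated Gaussian variables -/

section MomentCone

lemma exists_prod_of_mem_submonoid_closure {Ω ι : Type*} {G : ι → Ω → ℝ}
    {X : Ω → ℝ} (hX : X ∈ Submonoid.closure (Set.range G)) :
    ∃ (κ : Type) (_ : Fintype κ) (f : κ → ι), X = fun ω => ∏ k, G (f k) ω := by
  induction hX using Submonoid.closure_induction with
  | mem X hX =>
    obtain ⟨i, rfl⟩ := hX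
    exact ⟨Unit, inferInstance, fun _ => i, by simp⟩
  | one => exact ⟨Empty, inferInstance, Empty.elim, by ext; simp⟩
  | mul X Y _ _ hX hY =>
    obtain ⟨κ, _, f, rfl⟩ := hX
    obtain ⟨κ', _, f', rfl⟩ := hY
    exact ⟨κ ⊕ κ', inferInstance, Sum.elim f f', by ext; simp⟩

variable {Ω : Type*} [MeasurableSpace Ω] {P : Measure Ω}

/-- A version of Hölder's inequality: `‖XY‖_p ≤ ‖X‖_{2p} ‖Y‖_{2p}`. -/
lemma eLpNorm_mul_le_two_mul {X Y : Ω → ℝ} (hX : HasAllMoments P X) (hY : HasAllMoments P Y)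
    {p : ℝ≥0∞} (hp : p ≠ ∞) :
    eLpNorm (fun ω => X ω * Y ω) p P ≤ eLpNorm X (2 * p) P * eLpNorm Y (2 * p) P := by
  have := holderTriple_two_mul p
  have h := eLpNorm_smul_le_mul_eLpNorm (p := 2 * p) (q := 2 * p) (r := p) (hY p hp).1 (hX p hp).1
  exact h

/-- The convex cone of all random variables that are, in every `L_p`, `p < ∞`, limits of sums of
products of elements of `S`. -/
def momentCone (P : Measure Ω) (S : Set (Ω → ℝ)) : Set (Ω → ℝ) :=
  {X | HasAllMoments P X ∧ ∀ p : ℝ≥0∞, 1 ≤ p → p ≠ ∞ → ∀ ε : ℝ≥0∞, 0 < ε →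
    ∃ Y ∈ Subsemiring.closure S, eLpNorm (fun ω => X ω - Y ω) p P < ε}

lemma momentCone_congr_ae {S : Set (Ω → ℝ)} {X Y : Ω → ℝ}
    (hX : X ∈ momentCone P S) (h : X =ᵐ[P] Y) :
    Y ∈ momentCone P S := by
  refine ⟨hX.1.congr_ae h, fun p hp hp' ε hε => ?_⟩
  obtain ⟨Z, hZ, hlt⟩ := hX.2 p hp hp' ε hε
  refine ⟨Z, hZ, ?_⟩
  rwa [eLpNorm_congr_ae (g := fun ω => X ω - Z ω)]
  filter_upwards [h] with ω hω
  rw [hω]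

variable [IsProbabilityMeasure P] {S : Set (Ω → ℝ)} {X Y : Ω → ℝ}

lemma hasAllMoments_of_mem_closure (hS : ∀ X ∈ S, HasAllMoments P X)
    (hX : X ∈ Subsemiring.closure S) : HasAllMoments P X := by
  induction hX using Subsemiring.closure_induction with
  | mem X hX => exact hS X hX
  | zero => exact .const 0
  | one => exact .const 1
  | add X Y _ _ hX hY => exact hX.add hY
  | mul X Y _ _ hX hY => exact hX.mul hY

lemma subset_momentCone (hS : ∀ X ∈ S, HasAllMoments P X) (hX : X ∈ Subsemiring.closure S) :
    X ∈ momentCone P S :=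
  ⟨hasAllMoments_of_mem_closure hS hX, fun _ _ _ _ hε => ⟨X, hX, by simpa using hε⟩⟩

lemma momentCone_of_approx (hS : ∀ X ∈ S, HasAllMoments P X) (hX : HasAllMoments P X)
    (h : ∀ p : ℝ≥0∞, 1 ≤ p → p ≠ ∞ → ∀ ε : ℝ≥0∞, 0 < ε →
      ∃ Y ∈ momentCone P S, eLpNorm (fun ω => X ω - Y ω) p P < ε) :
    X ∈ momentCone P S := by
  refine ⟨hX, fun p hp hp' ε hε => ?_⟩
  have hε2 : 0 < ε / 2 := ENNReal.half_pos hε.ne'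
  obtain ⟨Y, hY, hXY⟩ := h p hp hp' _ hε2
  obtain ⟨Z, hZ, hYZ⟩ := hY.2 p hp hp' _ hε2
  refine ⟨Z, hZ, ?_⟩
  have e : (fun ω => X ω - Z ω) = (fun ω => X ω - Y ω) + fun ω => Y ω - Z ω := by
    ext ω; simp
  rw [e, ← ENNReal.add_halves ε]
  exact (eLpNorm_add_le ((hX.sub hY.1) p hp').1
    ((hY.1.sub (hasAllMoments_of_mem_closure hS hZ)) p hp').1 hp).trans_lt
    (ENNReal.add_lt_add hXY hYZ)

lemma add_mem_momentCone (hS : ∀ X ∈ S, HasAllMoments P X) (hX : X ∈ momentCone P S)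
    (hY : Y ∈ momentCone P S) : (fun ω => X ω + Y ω) ∈ momentCone P S := by
  refine ⟨hX.1.add hY.1, fun p hp hp' ε hε => ?_⟩
  have hε2 : 0 < ε / 2 := ENNReal.half_pos hε.ne'
  obtain ⟨X', hX', hXX⟩ := hX.2 p hp hp' _ hε2
  obtain ⟨Y', hY', hYY⟩ := hY.2 p hp hp' _ hε2
  refine ⟨X' + Y', add_mem hX' hY', ?_⟩
  have e : (fun ω => X ω + Y ω - (X' + Y') ω) = (fun ω => X ω - X' ω) + fun ω => Y ω - Y' ω := by
    ext ω; simp; ring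
  rw [e, ← ENNReal.add_halves ε]
  exact (eLpNorm_add_le ((hX.1.sub (hasAllMoments_of_mem_closure hS hX')) p hp').1
    ((hY.1.sub (hasAllMoments_of_mem_closure hS hY')) p hp').1 hp).trans_lt
    (ENNReal.add_lt_add hXX hYY)

lemma sum_mem_momentCone (hS : ∀ X ∈ S, HasAllMoments P X) {κ : Type*} (s : Finset κ)
    {X : κ → Ω → ℝ} (hX : ∀ k ∈ s, X k ∈ momentCone P S) :
    (fun ω => ∑ k ∈ s, X k ω) ∈ momentCone P S := by
  classical
  induction s using Finset.induction_on with
  | empty => simpa using! subset_momentCone hS (zero_mem (Subsemiring.closure S))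
  | insert k s hk ih =>
    simp only [Finset.sum_insert hk]
    exact add_mem_momentCone hS (hX k (by simp)) (ih fun j hj => hX j (by simp [hj]))

lemma mul_mem_momentCone (hS : ∀ X ∈ S, HasAllMoments P X) (hX : X ∈ momentCone P S)
    (hY : Y ∈ S) : (fun ω => X ω * Y ω) ∈ momentCone P S := by
  refine ⟨hX.1.mul (hS Y hY), fun p hp hp' ε hε => ?_⟩
  have h2p : 2 * p ≠ ∞ := ENNReal.mul_ne_top (by simp) hp'
  have hYfin : eLpNorm Y (2 * p) P ≠ ∞ := ((hS Y hY) _ h2p).2.ne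
  obtain ⟨X', hX', hXX⟩ := hX.2 (2 * p) (hp.trans (le_mul_of_one_le_left' one_le_two)) h2p
    (ε / (eLpNorm Y (2 * p) P + 1)) (ENNReal.div_pos hε.ne' (by simp [hYfin]))
  refine ⟨X' * Y, mul_mem hX' (Subsemiring.subset_closure hY), ?_⟩
  have e : (fun ω => X ω * Y ω - (X' * Y) ω) = fun ω => (X ω - X' ω) * Y ω := by
    ext ω; simp; ring
  rw [e]
  calc _ ≤ _ :=
        eLpNorm_mul_le_two_mul (hX.1.sub (hasAllMoments_of_mem_closure hS hX')) (hS Y hY) hp'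
    _ ≤ eLpNorm (fun ω => X ω - X' ω) (2 * p) P * (eLpNorm Y (2 * p) P + 1) := by
      gcongr; exact le_self_add
    _ < ε := by
      refine (ENNReal.lt_div_iff_mul_lt (by simp) (by simp [hYfin])).1 hXX

/-- The inequality `E[X] E[Z] ≤ E[X Z]` passes to limits in `X` with respect to the `L_2` norm. -/
lemma mul_integral_le_of_approx {Z : Ω → ℝ} (hX : HasAllMoments P X) (hZ : HasAllMoments P Z)
    (h : ∀ ε : ℝ≥0∞, 0 < ε → ∃ Y, HasAllMoments P Y ∧ eLpNorm (fun ω => X ω - Y ω) 2 P < ε ∧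
      (∫ ω, Y ω ∂P) * (∫ ω, Z ω ∂P) ≤ ∫ ω, Y ω * Z ω ∂P) :
    (∫ ω, X ω ∂P) * (∫ ω, Z ω ∂P) ≤ ∫ ω, X ω * Z ω ∂P := by
  obtain ⟨u, -, hupos, hu⟩ := exists_seq_strictAnti_tendsto' (show (0 : ℝ≥0∞) < 1 by simp)
  choose Y hY hXY hle using fun n => h (u n) (hupos n).1
  have hlim : Filter.Tendsto (fun n => eLpNorm (fun ω => X ω - Y n ω) 2 P) Filter.atTop (nhds 0) :=
    tendsto_of_tendsto_of_tendsto_of_le_of_le tendsto_const_nhds hu (fun _ => zero_le)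
      fun n => (hXY n).le
  have hsymm : ∀ n, eLpNorm (fun ω => X ω - Y n ω) 2 P = eLpNorm (Y n - X) 2 P := fun n =>
    eLpNorm_sub_comm X (Y n) 2 P
  have h1 : Filter.Tendsto (fun n => ∫ ω, Y n ω ∂P) Filter.atTop (nhds (∫ ω, X ω ∂P)) := by
    refine tendsto_integral_of_L1' X hX.integrable.1 (.of_forall fun n => (hY n).integrable)
      (tendsto_of_tendsto_of_tendsto_of_le_of_le tendsto_const_nhds hlim (fun _ => zero_le)
        fun n => ?_)
    rw [hsymm]
    exact eLpNorm_le_eLpNorm_of_exponent_le one_le_two (((hY n).sub hX).memLp_two).1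
  have h2 : Filter.Tendsto (fun n => ∫ ω, Y n ω * Z ω ∂P) Filter.atTop
      (nhds (∫ ω, X ω * Z ω ∂P)) := by
    have hlim' : Filter.Tendsto (fun n => eLpNorm (fun ω => X ω - Y n ω) 2 P * eLpNorm Z 2 P)
        Filter.atTop (nhds 0) := by
      simpa using ENNReal.Tendsto.mul_const hlim (Or.inr hZ.memLp_two.2.ne)
    refine tendsto_integral_of_L1' (fun ω => X ω * Z ω) (hX.mul hZ).integrable.1
      (.of_forall fun n => ((hY n).mul hZ).integrable)
      (tendsto_of_tendsto_of_tendsto_of_le_of_le tendsto_const_nhds hlim' (fun _ => zero_le)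
        fun n => ?_)
    have e : (fun ω => Y n ω * Z ω) - (fun ω => X ω * Z ω) = fun ω => (Y n ω - X ω) * Z ω := by
      ext ω; simp; ring
    simp only [e, hsymm]
    simpa using! eLpNorm_mul_le_two_mul ((hY n).sub hX) hZ (p := 1) (by simp)
  exact le_of_tendsto_of_tendsto' (h1.mul_const _) h2 hle

variable {ι : Type*} {G : ι → Ω → ℝ}

/-- Sums of products of jointly Gaussian variables with nonnegative means and covariances have
nonnegative means and are positively correlated. -/
lemma integral_nonneg_and_mul_integral_le_of_mem_closure (hG : IsGaussianProcess G P)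
    (hmean : ∀ i, 0 ≤ ∫ ω, G i ω ∂P) (hcov : ∀ i j, 0 ≤ cov[G i, G j; P])
    (hX : X ∈ Subsemiring.closure (Set.range G)) :
    0 ≤ ∫ ω, X ω ∂P ∧ ∀ Y ∈ Subsemiring.closure (Set.range G),
      (∫ ω, X ω ∂P) * (∫ ω, Y ω ∂P) ≤ ∫ ω, X ω * Y ω ∂P := by
  have hS : ∀ X ∈ Set.range G, HasAllMoments P X := by
    rintro _ ⟨i, rfl⟩; exact hG.hasAllMoments i
  have hmom : ∀ X ∈ AddSubmonoid.closure (Submonoid.closure (Set.range G) : Set (Ω → ℝ)),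
      HasAllMoments P X := fun X hX =>
    hasAllMoments_of_mem_closure hS (by rwa [← SetLike.mem_coe, Subsemiring.coe_closure_eq])
  rw [← SetLike.mem_coe, Subsemiring.coe_closure_eq, SetLike.mem_coe] at hX
  refine ⟨?_, fun Y hY => ?_⟩
  · induction hX using AddSubmonoid.closure_induction with
    | mem X hX =>
      obtain ⟨κ, _, f, rfl⟩ := exists_prod_of_mem_submonoid_closure hX
      exact (hG.comp_right f).integral_prod_nonneg (fun k => hmean (f k))
        (fun k l => hcov (f k) (f l)) Finset.univ
    | zero => simp
    | add X Y hX' hY' hX hY =>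
      simp only [Pi.add_apply]
      rw [integral_add (hmom X hX').integrable (hmom Y hY').integrable]
      exact add_nonneg hX hY
  · rw [← SetLike.mem_coe, Subsemiring.coe_closure_eq, SetLike.mem_coe] at hY
    induction hX using AddSubmonoid.closure_induction with
    | mem X hX =>
      have hXm := hmom X (AddSubmonoid.subset_closure hX)
      induction hY using AddSubmonoid.closure_induction with
      | mem Y hY =>
        obtain ⟨κ, _, f, rfl⟩ := exists_prod_of_mem_submonoid_closure hX
        obtain ⟨κ', _, f', rfl⟩ := exists_prod_of_mem_submonoid_closure hY
        have := (hG.comp_right (Sum.elim f f')).mul_integral_prod_le (fun k => hmean _)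
          (fun k l => hcov _ _) (Finset.univ.map .inl) (Finset.univ.map .inr)
          (by simp [Finset.disjoint_left])
        simpa using this
      | zero => simp
      | add Y Z hY' hZ' hY hZ =>
        simp only [Pi.add_apply, mul_add]
        rw [integral_add (hmom Y hY').integrable (hmom Z hZ').integrable,
          integral_add (hXm.mul (hmom Y hY')).integrable (hXm.mul (hmom Z hZ')).integrable]
        linarith
    | zero => simp
    | add X Z hX' hZ' hX hZ =>
      have hYm := hmom Y hY
      simp only [Pi.add_apply, add_mul]
      rw [integral_add (hmom X hX').integrable (hmom Z hZ').integrable,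
        integral_add ((hmom X hX').mul hYm).integrable ((hmom Z hZ').mul hYm).integrable]
      linarith

lemma integral_nonneg_of_mem_momentCone (hG : IsGaussianProcess G P)
    (hmean : ∀ i, 0 ≤ ∫ ω, G i ω ∂P) (hcov : ∀ i j, 0 ≤ cov[G i, G j; P])
    (hX : X ∈ momentCone P (Set.range G)) : 0 ≤ ∫ ω, X ω ∂P := by
  have hS : ∀ X ∈ Set.range G, HasAllMoments P X := by
    rintro _ ⟨i, rfl⟩; exact hG.hasAllMoments i
  obtain ⟨u, -, hupos, hu⟩ := exists_seq_strictAnti_tendsto' (show (0 : ℝ≥0∞) < 1 by simp)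
  choose Y hY hXY using fun n => hX.2 1 le_rfl (by simp) (u n) (hupos n).1
  have hYm := fun n => hasAllMoments_of_mem_closure hS (hY n)
  have h1 : Filter.Tendsto (fun n => ∫ ω, Y n ω ∂P) Filter.atTop (nhds (∫ ω, X ω ∂P)) := by
    refine tendsto_integral_of_L1' X hX.1.integrable.1 (.of_forall fun n => (hYm n).integrable)
      (tendsto_of_tendsto_of_tendsto_of_le_of_le tendsto_const_nhds hu (fun _ => zero_le)
        fun n => ?_)
    exact (eLpNorm_sub_comm (Y n) X 1 P).trans_le (hXY n).le
  exact ge_of_tendsto' h1 fun n =>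
    (integral_nonneg_and_mul_integral_le_of_mem_closure hG hmean hcov (hY n)).1

/-- Elements of the closed cone are positively correlated. -/
lemma mul_integral_le_of_mem_momentCone (hG : IsGaussianProcess G P)
    (hmean : ∀ i, 0 ≤ ∫ ω, G i ω ∂P) (hcov : ∀ i j, 0 ≤ cov[G i, G j; P])
    (hX : X ∈ momentCone P (Set.range G)) (hY : Y ∈ momentCone P (Set.range G)) :
    (∫ ω, X ω ∂P) * (∫ ω, Y ω ∂P) ≤ ∫ ω, X ω * Y ω ∂P := by
  have hS : ∀ X ∈ Set.range G, HasAllMoments P X := by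
    rintro _ ⟨i, rfl⟩; exact hG.hasAllMoments i
  refine mul_integral_le_of_approx hX.1 hY.1 fun ε hε => ?_
  obtain ⟨X', hX', hXX⟩ := hX.2 2 one_le_two (by simp) ε hε
  have hXm := hasAllMoments_of_mem_closure hS hX'
  refine ⟨X', hXm, hXX, ?_⟩
  simp only [mul_comm (∫ ω, X' ω ∂P), mul_comm (X' _)]
  refine mul_integral_le_of_approx hY.1 hXm fun ε' hε' => ?_
  obtain ⟨Y', hY', hYY⟩ := hY.2 2 one_le_two (by simp) ε' hε'
  exact ⟨Y', hasAllMoments_of_mem_closure hS hY', hYY,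
    (integral_nonneg_and_mul_integral_le_of_mem_closure hG hmean hcov hY').2 _ hX'⟩

/-- Second moment and variance are monotone for the order defined by the closed cone. -/
lemma integral_sq_le_of_mem_momentCone (hG : IsGaussianProcess G P)
    (hmean : ∀ i, 0 ≤ ∫ ω, G i ω ∂P) (hcov : ∀ i j, 0 ≤ cov[G i, G j; P])
    (hX : X ∈ momentCone P (Set.range G))
    (hXY : (fun ω => Y ω - X ω) ∈ momentCone P (Set.range G)) :
    ∫ ω, |X ω| ^ 2 ∂P ≤ ∫ ω, |Y ω| ^ 2 ∂P ∧
      ∫ ω, |X ω - ∫ ω', X ω' ∂P| ^ 2 ∂P ≤ ∫ ω, |Y ω - ∫ ω', Y ω' ∂P| ^ 2 ∂P := by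
  have hS : ∀ X ∈ Set.range G, HasAllMoments P X := by
    rintro _ ⟨i, rfl⟩; exact hG.hasAllMoments i
  have hY : Y ∈ momentCone P (Set.range G) := by
    simpa using add_mem_momentCone hS hX hXY
  have hsum := add_mem_momentCone hS hX hY
  have hle := mul_integral_le_of_mem_momentCone hG hmean hcov hXY hsum
  have h0 := mul_nonneg (integral_nonneg_of_mem_momentCone hG hmean hcov hXY)
    (integral_nonneg_of_mem_momentCone hG hmean hcov hsum)
  have e : ∀ ω, (Y ω - X ω) * (X ω + Y ω) = Y ω * Y ω - X ω * X ω := fun ω => by ring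
  simp only [e] at hle
  have hX2 := (hX.1.mul hX.1).integrable
  have hY2 := (hY.1.mul hY.1).integrable
  rw [integral_sub hY2 hX2] at hle
  rw [integral_sub hY.1.integrable hX.1.integrable, integral_add hX.1.integrable hY.1.integrable]
    at hle h0
  have hvar : ∀ Z : Ω → ℝ, HasAllMoments P Z → ∫ ω, |Z ω - ∫ ω', Z ω' ∂P| ^ 2 ∂P
      = ∫ ω, Z ω * Z ω ∂P - (∫ ω, Z ω ∂P) ^ 2 := by
    intro Z hZ
    have := variance_eq_sub hZ.memLp_two
    rw [variance_eq_integral hZ.integrable.aemeasurable] at this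
    simpa [sq_abs, sq] using this
  rw [hvar X hX.1, hvar Y hY.1]
  simp only [sq_abs]
  simp only [sq] at hle h0 ⊢
  constructor <;> linarith

end MomentCone

/-! ### Riemann–Stieltjes integrals in all `L_p` -/

section RSIntegral

namespace TaggedPartition

variable {T : ℝ≥0}

lemma pt_mem (π : TaggedPartition T) (i : Fin (π.m + 1)) : π.pt i ∈ Set.Icc 0 T :=
  ⟨zero_le, (π.strictMono.monotone (Fin.le_last i)).trans_eq π.pt_last⟩

lemma tag_mem_Icc (π : TaggedPartition T) (i : Fin π.m) : π.tag i ∈ Set.Icc 0 T :=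
  ⟨zero_le, (π.tag_mem i).2.trans (π.pt_mem _).2⟩

lemma pt_castSucc_le (π : TaggedPartition T) (i : Fin π.m) : π.pt i.castSucc ≤ π.pt i.succ :=
  (π.tag_mem i).1.trans (π.tag_mem i).2

lemma exists_meshLT (T : ℝ≥0) {δ : ℝ} (hδ : 0 < δ) : ∃ π : TaggedPartition T, π.MeshLT δ := by
  rcases eq_or_ne T 0 with rfl | hT
  · exact ⟨⟨0, fun _ => 0, fun i j h => absurd h (by omega), rfl, rfl, fun _ => 0,
      fun i => i.elim0⟩, fun i => i.elim0⟩
  have hTpos : 0 < T := pos_iff_ne_zero.2 hT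
  obtain ⟨m, hm⟩ := exists_nat_gt ((T : ℝ) / δ)
  have hm0 : 0 < (m : ℝ) := (div_nonneg T.2 hδ.le).trans_lt hm
  have hm0' : (0 : ℝ≥0) < m := by exact_mod_cast hm0
  refine ⟨⟨m, fun i => T * i / m, fun i j hij => ?_, by simp, ?_, fun i => T * i / m, fun i => ?_⟩,
    fun i => ?_⟩
  · have : (i : ℝ≥0) < j := by exact_mod_cast hij
    dsimp only
    gcongr
  · simp [hm0'.ne']
  · refine ⟨le_of_eq (by simp), ?_⟩
    simp only [Fin.val_succ]
    gcongr
    simp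
  · have : ((T * (i.succ : ℕ) / m : ℝ≥0) : ℝ) - ((T * (i.castSucc : ℕ) / m : ℝ≥0) : ℝ) = T / m := by
      push_cast [Fin.val_succ, Fin.val_castSucc]
      ring
    change ((T * (i.succ : ℕ) / m : ℝ≥0) : ℝ) - ((T * (i.castSucc : ℕ) / m : ℝ≥0) : ℝ) < δ
    rw [this, div_lt_iff₀ hm0, mul_comm]
    exact (div_lt_iff₀ hδ).1 hm

variable {Ω : Type*} [MeasurableSpace Ω] {P : Measure Ω} {f f' g : ℝ≥0 → Ω → ℝ}

lemma hasAllMoments_rsSum (π : TaggedPartition T) (hf : ∀ s ∈ Set.Icc 0 T, HasAllMoments P (f s))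
    (hg : ∀ s, HasAllMoments P (g s)) : HasAllMoments P (π.rsSum f g) :=
  .finset_sum fun i _ => (hf _ (π.tag_mem_Icc i)).mul ((hg _).sub (hg _))

lemma rsSum_congr_ae (π : TaggedPartition T) (h : ∀ s ∈ Set.Icc 0 T, f s =ᵐ[P] f' s) :
    π.rsSum f g =ᵐ[P] π.rsSum f' g := by
  have : ∀ᵐ ω ∂P, ∀ i : Fin π.m, f (π.tag i) ω = f' (π.tag i) ω :=
    ae_all_iff.2 fun i => h _ (π.tag_mem_Icc i)
  filter_upwards [this] with ω hω
  simp [rsSum, hω]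

end TaggedPartition

variable {Ω : Type*} [MeasurableSpace Ω] {P : Measure Ω}
  {T : ℝ≥0} {f f' g : ℝ≥0 → Ω → ℝ} {Y Y' : Ω → ℝ}

/-- Riemann–Stieltjes sums of `f` against `g` converge to `Y` in `L_p`, for one fixed `p`. -/
def RSConverges (P : Measure Ω) (T : ℝ≥0) (p : ℝ≥0∞) (f g : ℝ≥0 → Ω → ℝ) (Y : Ω → ℝ) : Prop :=
  ∀ ε : ℝ≥0∞, 0 < ε → ∃ δ : ℝ, 0 < δ ∧ ∀ π : TaggedPartition T, π.MeshLT δ →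
    eLpNorm (fun ω => π.rsSum f g ω - Y ω) p P < ε

lemma RSConverges.ae_unique [IsProbabilityMeasure P] {p : ℝ≥0∞} (hp : 1 ≤ p) (hp' : p ≠ ∞)
    (hf : ∀ s ∈ Set.Icc 0 T, HasAllMoments P (f s)) (hg : ∀ s, HasAllMoments P (g s))
    (hff : ∀ s ∈ Set.Icc 0 T, f s =ᵐ[P] f' s) (hY : MemLp Y p P) (hY' : MemLp Y' p P)
    (h : RSConverges P T p f g Y) (h' : RSConverges P T p f' g Y') : Y =ᵐ[P] Y' := by
  have hzero : eLpNorm (Y - Y') p P = 0 := by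
    refine le_antisymm (le_of_forall_gt fun ε hε => ?_) zero_le
    have hε2 : 0 < ε / 2 := ENNReal.half_pos hε.ne'
    obtain ⟨δ, hδ, H⟩ := h _ hε2
    obtain ⟨δ', hδ', H'⟩ := h' _ hε2
    obtain ⟨π, hπ⟩ := TaggedPartition.exists_meshLT T (lt_min hδ hδ')
    have h1 := H π fun i => (hπ i).trans_le (min_le_left _ _)
    have h2 := H' π fun i => (hπ i).trans_le (min_le_right _ _)
    have hS := π.hasAllMoments_rsSum hf hg p hp'
    have e : Y - Y' =ᵐ[P] (fun ω => π.rsSum f' g ω - Y' ω) - fun ω => π.rsSum f g ω - Y ω := by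
      filter_upwards [π.rsSum_congr_ae (g := g) hff] with ω hω
      simp [hω]
    rw [eLpNorm_congr_ae e, ← ENNReal.add_halves ε]
    exact (eLpNorm_sub_le (((memLp_congr_ae (π.rsSum_congr_ae hff)).1 hS).sub hY').1
      (hS.sub hY).1 hp).trans_lt (ENNReal.add_lt_add h2 h1)
  rw [eLpNorm_eq_zero_iff (hY.sub hY').1 (by positivity)] at hzero
  filter_upwards [hzero] with ω hω
  simpa [sub_eq_zero] using hω

namespace HasRSIntegral

lemma rsConverges (h : HasRSIntegral P T f g Y) {p : ℝ≥0∞} (hp : 1 ≤ p) (hp' : p ≠ ∞) :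
    RSConverges P T p f g Y := (h p hp hp').2

lemma hasAllMoments [IsProbabilityMeasure P] (h : HasRSIntegral P T f g Y) : HasAllMoments P Y :=
  .of_one_le fun p hp hp' => (h p hp hp').1

lemma zero : HasRSIntegral P T (fun _ _ => 0) g (fun _ => 0) := fun p _ _ =>
  ⟨MemLp.zero, fun ε hε => ⟨1, one_pos, fun π _ => by simpa [TaggedPartition.rsSum] using hε⟩⟩

lemma congr (h : HasRSIntegral P T f g Y) (hf : ∀ s ∈ Set.Icc 0 T, f s = f' s) :
    HasRSIntegral P T f' g Y := fun p hp hp' =>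
  ⟨(h p hp hp').1, fun ε hε => by
    obtain ⟨δ, hδ, H⟩ := (h p hp hp').2 ε hε
    refine ⟨δ, hδ, fun π hπ => ?_⟩
    have e : π.rsSum f' g = π.rsSum f g := by
      ext ω
      exact Finset.sum_congr rfl fun i _ => by rw [hf _ (π.tag_mem_Icc i)]
    rw [e]
    exact H π hπ⟩

variable [IsProbabilityMeasure P]

/-- Linearity of the integral in the integrand, in the form needed for the combinations with
coefficients `±1` below. -/
lemma add_mul (h : HasRSIntegral P T f g Y) (h' : HasRSIntegral P T f' g Y')
    (hf : ∀ s ∈ Set.Icc 0 T, HasAllMoments P (f s))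
    (hf' : ∀ s ∈ Set.Icc 0 T, HasAllMoments P (f' s)) (hg : ∀ s, HasAllMoments P (g s))
    {c : ℝ} (hc : |c| = 1) :
    HasRSIntegral P T (fun s ω => f s ω + c * f' s ω) g (fun ω => Y ω + c * Y' ω) :=
    fun p hp hp' => by
  refine ⟨(h.hasAllMoments.add (h'.hasAllMoments.const_mul c)) p hp', fun ε hε => ?_⟩
  have hε2 : 0 < ε / 2 := ENNReal.half_pos hε.ne'
  obtain ⟨δ, hδ, H⟩ := (h p hp hp').2 _ hε2
  obtain ⟨δ', hδ', H'⟩ := (h' p hp hp').2 _ hε2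
  refine ⟨min δ δ', lt_min hδ hδ', fun π hπ => ?_⟩
  have h1 := H π fun i => (hπ i).trans_le (min_le_left _ _)
  have h2 := H' π fun i => (hπ i).trans_le (min_le_right _ _)
  have e : (fun ω => π.rsSum (fun s ω => f s ω + c * f' s ω) g ω - (Y ω + c * Y' ω))
      = (fun ω => π.rsSum f g ω - Y ω) + c • fun ω => π.rsSum f' g ω - Y' ω := by
    ext ω
    simp only [TaggedPartition.rsSum, Pi.add_apply, Pi.smul_apply, smul_eq_mul, _root_.add_mul,
      Finset.sum_add_distrib, mul_assoc, ← Finset.mul_sum]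
    ring
  have m1 := ((π.hasAllMoments_rsSum hf hg).sub h.hasAllMoments) p hp'
  have m2 := ((π.hasAllMoments_rsSum hf' hg).sub h'.hasAllMoments) p hp'
  rw [e, ← ENNReal.add_halves ε]
  refine (eLpNorm_add_le m1.1 (m2.1.const_smul c) hp).trans_lt (ENNReal.add_lt_add h1 ?_)
  rw [eLpNorm_const_smul, ← ofReal_norm, Real.norm_eq_abs, hc]
  simpa using h2

/-- Monotonicity of the integral with respect to the order defined by the closed cone: this is
where the positivity of the increments of the integrator enters. -/
lemma sub_mem_momentCone {S : Set (Ω → ℝ)} (hS : ∀ X ∈ S, HasAllMoments P X)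
    (h : HasRSIntegral P T f g Y) (h' : HasRSIntegral P T f' g Y')
    (hf : ∀ s ∈ Set.Icc 0 T, HasAllMoments P (f s))
    (hf' : ∀ s ∈ Set.Icc 0 T, HasAllMoments P (f' s)) (hg : ∀ s, HasAllMoments P (g s))
    (hgS : ∀ u v, u ≤ v → (fun ω => g v ω - g u ω) ∈ S)
    (hff : ∀ s ∈ Set.Icc 0 T, (fun ω => f' s ω - f s ω) ∈ momentCone P S) :
    (fun ω => Y' ω - Y ω) ∈ momentCone P S := by
  have hint := h'.add_mul h hf' hf hg (c := -1) (by simp)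
  refine momentCone_of_approx hS (h'.hasAllMoments.sub h.hasAllMoments) fun p hp hp' ε hε => ?_
  obtain ⟨δ, hδ, H⟩ := (hint p hp hp').2 ε hε
  obtain ⟨π, hπ⟩ := TaggedPartition.exists_meshLT T hδ
  refine ⟨π.rsSum (fun s ω => f' s ω - f s ω) g, sum_mem_momentCone hS _ fun i _ =>
    mul_mem_momentCone hS (hff _ (π.tag_mem_Icc i)) (hgS _ _ (π.pt_castSucc_le i)), ?_⟩
  have e := eLpNorm_sub_comm (fun ω => Y' ω - Y ω) (π.rsSum (fun s ω => f' s ω - f s ω) g) p P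
  refine e.trans_lt ?_
  simpa only [neg_mul, one_mul, ← sub_eq_add_neg] using! H π hπ

end HasRSIntegral

end RSIntegral

/-! ### Multiple integrals: uniqueness, monotonicity, inclusion–exclusion -/

section MultipleIntegral

variable {Ω : Type*} [MeasurableSpace Ω] {P : Measure Ω} {T : ℝ≥0}

lemma hasMultipleIntegral_empty {r : ℕ} (B : Fin r → ℝ≥0 → Ω → ℝ) :
    HasMultipleIntegral P T r B ∅ (fun _ => 0) := by
  induction r with
  | zero => simp [HasMultipleIntegral]
  | succ r ih => exact ⟨fun _ _ => 0, fun s _ => ih _, HasRSIntegral.zero⟩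

variable [IsProbabilityMeasure P]

lemma HasMultipleIntegral.hasAllMoments {r : ℕ} {B : Fin r → ℝ≥0 → Ω → ℝ}
    {A : Set (Fin r → ℝ≥0)} {J : Ω → ℝ} (h : HasMultipleIntegral P T r B A J) :
    HasAllMoments P J := by
  cases r with
  | zero => exact (HasAllMoments.const _).congr_ae (Filter.EventuallyEq.symm h)
  | succ r =>
    obtain ⟨F, -, hF⟩ := h
    exact hF.hasAllMoments

lemma HasMultipleIntegral.ae_unique {r : ℕ} {B : Fin r → ℝ≥0 → Ω → ℝ}
    (hB : ∀ j t, HasAllMoments P (B j t)) {A : Set (Fin r → ℝ≥0)} {J J' : Ω → ℝ}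
    (h : HasMultipleIntegral P T r B A J) (h' : HasMultipleIntegral P T r B A J') :
    J =ᵐ[P] J' := by
  induction r generalizing J J' with
  | zero => exact Filter.EventuallyEq.trans h (Filter.EventuallyEq.symm h')
  | succ r ih =>
    obtain ⟨F, hF, hJ⟩ := h
    obtain ⟨F', hF', hJ'⟩ := h'
    exact RSConverges.ae_unique le_rfl (by simp) (fun s hs => (hF s hs).hasAllMoments) (hB _)
      (fun s hs => ih (fun j => hB _) (hF s hs) (hF' s hs)) (hJ 1 le_rfl (by simp)).1
      (hJ' 1 le_rfl (by simp)).1 (hJ.rsConverges le_rfl (by simp))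
      (hJ'.rsConverges le_rfl (by simp))

/-- A larger set has a larger multiple integral, in the order defined by the closed cone that the
increments of the integrators generate. -/
lemma HasMultipleIntegral.sub_mem_momentCone {S : Set (Ω → ℝ)} (hS : ∀ X ∈ S, HasAllMoments P X)
    {r : ℕ} {B : Fin r → ℝ≥0 → Ω → ℝ} (hB : ∀ j t, HasAllMoments P (B j t))
    (hBS : ∀ j u v, u ≤ v → (fun ω => B j v ω - B j u ω) ∈ S)
    {A A' : Set (Fin r → ℝ≥0)} (hA : A ⊆ A') {J J' : Ω → ℝ}
    (h : HasMultipleIntegral P T r B A J) (h' : HasMultipleIntegral P T r B A' J') :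
    (fun ω => J' ω - J ω) ∈ momentCone P S := by
  induction r generalizing J J' with
  | zero =>
    simp only [HasMultipleIntegral] at h h'
    have h0 := subset_momentCone hS (zero_mem (Subsemiring.closure S))
    have h1 := subset_momentCone hS (one_mem (Subsemiring.closure S))
    by_cases hA1 : (Fin.elim0 : Fin 0 → ℝ≥0) ∈ A
    · refine momentCone_congr_ae h0 ?_
      filter_upwards [h, h'] with ω e e'
      simp [e, e', hA1, hA hA1]
    · by_cases hA2 : (Fin.elim0 : Fin 0 → ℝ≥0) ∈ A'
      · refine momentCone_congr_ae h1 ?_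
        filter_upwards [h, h'] with ω e e'
        simp [e, e', hA1, hA2]
      · refine momentCone_congr_ae h0 ?_
        filter_upwards [h, h'] with ω e e'
        simp [e, e', hA1, hA2]
  | succ r ih =>
    obtain ⟨F, hF, hJ⟩ := h
    obtain ⟨F', hF', hJ'⟩ := h'
    exact hJ.sub_mem_momentCone hS hJ' (fun s hs => (hF s hs).hasAllMoments)
      (fun s hs => (hF' s hs).hasAllMoments) (hB _) (hBS _) fun s hs =>
        ih (fun j => hB _) (fun j => hBS _) (fun x hx => hA hx) (hF s hs) (hF' s hs)

lemma HasMultipleIntegral.mem_momentCone {S : Set (Ω → ℝ)} (hS : ∀ X ∈ S, HasAllMoments P X)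
    {r : ℕ} {B : Fin r → ℝ≥0 → Ω → ℝ} (hB : ∀ j t, HasAllMoments P (B j t))
    (hBS : ∀ j u v, u ≤ v → (fun ω => B j v ω - B j u ω) ∈ S)
    {A : Set (Fin r → ℝ≥0)} {J : Ω → ℝ} (h : HasMultipleIntegral P T r B A J) :
    J ∈ momentCone P S := by
  simpa using (hasMultipleIntegral_empty B).sub_mem_momentCone hS hB hBS (Set.empty_subset A) h

lemma HasMultipleIntegral.union {r : ℕ} {B : Fin r → ℝ≥0 → Ω → ℝ}
    (hB : ∀ j t, HasAllMoments P (B j t)) {A₁ A₂ : Set (Fin r → ℝ≥0)} {J₁ J₂ J₃ : Ω → ℝ}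
    (h₁ : HasMultipleIntegral P T r B A₁ J₁) (h₂ : HasMultipleIntegral P T r B A₂ J₂)
    (h₃ : HasMultipleIntegral P T r B (A₁ ∩ A₂) J₃) :
    HasMultipleIntegral P T r B (A₁ ∪ A₂) (fun ω => J₁ ω + 1 * J₂ ω + -1 * J₃ ω) := by
  induction r generalizing J₁ J₂ J₃ with
  | zero =>
    simp only [HasMultipleIntegral] at h₁ h₂ h₃ ⊢
    filter_upwards [h₁, h₂, h₃] with ω e₁ e₂ e₃
    rw [e₁, e₂, e₃]
    by_cases hA₁ : (Fin.elim0 : Fin 0 → ℝ≥0) ∈ A₁ <;>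
      by_cases hA₂ : (Fin.elim0 : Fin 0 → ℝ≥0) ∈ A₂ <;> simp [hA₁, hA₂]
  | succ r ih =>
    obtain ⟨F₁, hF₁, hJ₁⟩ := h₁
    obtain ⟨F₂, hF₂, hJ₂⟩ := h₂
    obtain ⟨F₃, hF₃, hJ₃⟩ := h₃
    have m₁ := fun s hs => (hF₁ s hs).hasAllMoments
    have m₂ := fun s hs => (hF₂ s hs).hasAllMoments
    have m₃ := fun s hs => (hF₃ s hs).hasAllMoments
    exact ⟨_, fun s hs => ih (fun j => hB _) (hF₁ s hs) (hF₂ s hs) (hF₃ s hs),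
      (hJ₁.add_mul hJ₂ m₁ m₂ (hB _) (by simp)).add_mul hJ₃
        (fun s hs => (m₁ s hs).add ((m₂ s hs).const_mul 1)) m₃ (hB _) (by simp)⟩

end MultipleIntegral

/-! ### The sewing lemma -/

section Sewing

variable {E : Type*} [NormedAddCommGroup E] {Ξ : ℝ≥0 → ℝ≥0 → E} {C θ : ℝ}

/-- `Ξ` is almost additive of order `θ`: its defect of additivity on `[u, w]` is `O((w - u)^θ)`. -/
def AlmostAdditive (Ξ : ℝ≥0 → ℝ≥0 → E) (C θ : ℝ) : Prop :=
  ∀ u v w : ℝ≥0, u ≤ v → v ≤ w → ‖Ξ u w - Ξ u v - Ξ v w‖ ≤ C * ((w : ℝ) - u) ^ θ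

lemma AlmostAdditive.self_eq_zero (hΞ : AlmostAdditive Ξ C θ) (hθ : 1 < θ) (u : ℝ≥0) :
    Ξ u u = 0 := by
  have := hΞ u u u le_rfl le_rfl
  simpa [Real.zero_rpow (by linarith : θ ≠ 0)] using this

/-- The constant in the sewing lemma: the geometric series `2 C (1 + 2^(1-θ) + 2^(2(1-θ)) + ⋯)`. -/
noncomputable def sewingConst (C θ : ℝ) : ℝ := 2 * C / (1 - 2 ^ (1 - θ))

lemma two_rpow_one_sub_lt_one (hθ : 1 < θ) : (2 : ℝ) ^ (1 - θ) < 1 :=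
  Real.rpow_lt_one_of_one_lt_of_neg one_lt_two (by linarith)

lemma sewingConst_nonneg (hθ : 1 < θ) (hC : 0 ≤ C) : 0 ≤ sewingConst C θ :=
  div_nonneg (by linarith) (by linarith [two_rpow_one_sub_lt_one hθ])

lemma sewingConst_eq (hθ : 1 < θ) :
    sewingConst C θ * 2 ^ (1 - θ) + 2 * C = sewingConst C θ := by
  have : 1 - (2 : ℝ) ^ (1 - θ) ≠ 0 := by linarith [two_rpow_one_sub_lt_one hθ]
  rw [sewingConst]
  field_simp
  ring

lemma two_mul_half_rpow (θ : ℝ) {L : ℝ} (hL : 0 ≤ L) :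
    2 * (L / 2) ^ θ = 2 ^ (1 - θ) * L ^ θ := by
  rw [Real.div_rpow hL (by norm_num), Real.rpow_sub (by norm_num), Real.rpow_one]
  ring

lemma exists_mid_index {x : ℕ → ℝ≥0} (hx : Monotone x) {n : ℕ} (hn : 0 < n) {m : ℝ}
    (h0 : x 0 ≤ m) (h1 : m ≤ x n) : ∃ i < n, (x i : ℝ) ≤ m ∧ m ≤ x (i + 1) := by
  classical
  have hex : ∃ k, m ≤ x k := ⟨n, h1⟩
  rcases Nat.eq_zero_or_pos (Nat.find hex) with hk | hk
  · have := Nat.find_spec hex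
    rw [hk] at this
    exact ⟨0, hn, h0, this.trans (by exact_mod_cast hx (Nat.zero_le _))⟩
  · refine ⟨Nat.find hex - 1, ?_, ?_, ?_⟩
    · have := Nat.find_min' hex h1
      omega
    · exact (not_le.1 (Nat.find_min hex (Nat.sub_lt hk one_pos))).le
    · rw [Nat.sub_add_cancel hk]
      exact Nat.find_spec hex

/-- Young's maximal inequality: the sums of an almost additive `Ξ` along any partition of an
interval stay close to the value of `Ξ` on that interval. The partition is cut at the cell that
contains the midpoint, and both remaining parts have at most half the length. -/
lemma AlmostAdditive.norm_sum_sub_le (hΞ : AlmostAdditive Ξ C θ) (hθ : 1 < θ) (hC : 0 ≤ C) (n : ℕ)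
    {x : ℕ → ℝ≥0} (hx : Monotone x) :
    ‖∑ i ∈ Finset.range n, Ξ (x i) (x (i + 1)) - Ξ (x 0) (x n)‖
      ≤ sewingConst C θ * ((x n : ℝ) - x 0) ^ θ := by
  induction n using Nat.strong_induction_on generalizing x with
  | _ n ih =>
    have hK := sewingConst_nonneg hθ hC
    rcases Nat.eq_zero_or_pos n with rfl | hn
    · simp [hΞ.self_eq_zero hθ, Real.zero_rpow (by linarith : θ ≠ 0)]
    have hmono : ∀ {a b}, a ≤ b → (x a : ℝ) ≤ x b := fun h => by exact_mod_cast hx h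
    obtain ⟨i, hi, hi1, hi2⟩ := exists_mid_index hx hn (m := ((x 0 : ℝ) + x n) / 2)
      (by linarith [hmono hn.le]) (by linarith [hmono hn.le])
    obtain ⟨j, rfl⟩ : ∃ j, n = i + 1 + j := ⟨n - (i + 1), by omega⟩
    have H1 := ih i hi hx
    have H2 := ih j (by omega) (x := fun k => x (i + 1 + k)) (fun a b h => hx (by omega))
    rw [Finset.sum_range_add, Finset.sum_range_succ]
    have D1 := hΞ (x 0) (x i) (x (i + 1)) (hx (Nat.zero_le _)) (hx (Nat.le_succ _))
    have D2 := hΞ (x 0) (x (i + 1)) (x (i + 1 + j)) (hx (Nat.zero_le _)) (hx (Nat.le_add_right _ _))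
    set L : ℝ := (x (i + 1 + j) : ℝ) - x 0 with hLdef
    have hL : 0 ≤ L := sub_nonneg.2 (hmono (Nat.zero_le _))
    have b1 : ((x i : ℝ) - x 0) ^ θ ≤ (L / 2) ^ θ :=
      Real.rpow_le_rpow (sub_nonneg.2 (hmono (Nat.zero_le _))) (by linarith) (by linarith)
    have b2 : ((x (i + 1 + j) : ℝ) - x (i + 1)) ^ θ ≤ (L / 2) ^ θ :=
      Real.rpow_le_rpow (sub_nonneg.2 (hmono (Nat.le_add_right _ _))) (by linarith) (by linarith)
    have b3 : ((x (i + 1) : ℝ) - x 0) ^ θ ≤ L ^ θ :=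
      Real.rpow_le_rpow (sub_nonneg.2 (hmono (Nat.zero_le _)))
        (by linarith [hmono (Nat.le_add_right (i + 1) j)]) (by linarith)
    have e : ∑ k ∈ Finset.range i, Ξ (x k) (x (k + 1)) + Ξ (x i) (x (i + 1))
          + ∑ k ∈ Finset.range j, Ξ (x (i + 1 + k)) (x (i + 1 + k + 1)) - Ξ (x 0) (x (i + 1 + j))
        = (∑ k ∈ Finset.range i, Ξ (x k) (x (k + 1)) - Ξ (x 0) (x i))
          + (∑ k ∈ Finset.range j, Ξ (x (i + 1 + k)) (x (i + 1 + (k + 1)))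
              - Ξ (x (i + 1 + 0)) (x (i + 1 + j)))
          - (Ξ (x 0) (x (i + 1)) - Ξ (x 0) (x i) - Ξ (x i) (x (i + 1)))
          - (Ξ (x 0) (x (i + 1 + j)) - Ξ (x 0) (x (i + 1)) - Ξ (x (i + 1)) (x (i + 1 + j))) := by
      simp only [add_zero, add_assoc]
      abel
    rw [e]
    calc _ ≤ sewingConst C θ * (L / 2) ^ θ + sewingConst C θ * (L / 2) ^ θ + C * L ^ θ
          + C * L ^ θ := by
          refine (norm_sub_le _ _).trans (add_le_add ((norm_sub_le _ _).trans (add_le_add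
            ((norm_add_le _ _).trans (add_le_add ?_ ?_)) ?_)) D2)
          · exact H1.trans (mul_le_mul_of_nonneg_left b1 hK)
          · exact H2.trans (mul_le_mul_of_nonneg_left b2 hK)
          · exact D1.trans (mul_le_mul_of_nonneg_left b3 hC)
      _ = (sewingConst C θ * 2 ^ (1 - θ) + 2 * C) * L ^ θ := by
          have := two_mul_half_rpow θ hL
          linear_combination sewingConst C θ * this
      _ = _ := by rw [sewingConst_eq hθ]

/-- The sum of `Ξ` along the dyadic grid of mesh `2⁻ᴺ`, stopped at time `t ≤ M`. -/
noncomputable def dyadicSum (Ξ : ℝ≥0 → ℝ≥0 → E) (M N : ℕ) (t : ℝ≥0) : E :=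
  ∑ k ∈ Finset.range (M * 2 ^ N), Ξ (min (k * (1 / 2) ^ N) t) (min ((k + 1 : ℕ) * (1 / 2) ^ N) t)

lemma sum_range_mul_two {F : Type*} [AddCommMonoid F] (f : ℕ → F) (n : ℕ) :
    ∑ i ∈ Finset.range (n * 2), f i = ∑ k ∈ Finset.range n, (f (2 * k) + f (2 * k + 1)) := by
  induction n with
  | zero => simp
  | succ n ih =>
    rw [Finset.sum_range_succ, ← ih, add_mul, one_mul, Finset.sum_range_succ,
      Finset.sum_range_succ, mul_comm 2 n, add_assoc]

lemma min_sub_min_le {a b : ℝ≥0} (t : ℝ≥0) (hab : a ≤ b) :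
    ((min b t : ℝ≥0) : ℝ) - (min a t : ℝ≥0) ≤ b - a := by
  have : (a : ℝ) ≤ b := by exact_mod_cast hab
  rw [NNReal.coe_min, NNReal.coe_min]
  rcases le_total (a : ℝ) t with h | h
  · rw [min_eq_left h]; linarith [min_le_left (b : ℝ) t]
  · rw [min_eq_right h]; linarith [min_le_right (b : ℝ) t]

lemma AlmostAdditive.dist_dyadicSum_succ_le (hΞ : AlmostAdditive Ξ C θ) (hθ : 1 < θ) (hC : 0 ≤ C)
    (M N : ℕ) (t : ℝ≥0) :
    dist (dyadicSum Ξ M N t) (dyadicSum Ξ M (N + 1) t) ≤ M * C * (2 ^ (1 - θ) : ℝ) ^ N := by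
  rw [dist_eq_norm, dyadicSum, dyadicSum, pow_succ, ← mul_assoc, sum_range_mul_two,
    ← Finset.sum_sub_distrib]
  have hterm : ∀ k ∈ Finset.range (M * 2 ^ N), ‖Ξ (min (k * (1 / 2) ^ N) t)
        (min ((k + 1 : ℕ) * (1 / 2) ^ N) t)
      - (Ξ (min ((2 * k : ℕ) * (1 / 2) ^ (N + 1)) t) (min ((2 * k + 1 : ℕ) * (1 / 2) ^ (N + 1)) t)
        + Ξ (min ((2 * k + 1 : ℕ) * (1 / 2) ^ (N + 1)) t)
          (min ((2 * k + 1 + 1 : ℕ) * (1 / 2) ^ (N + 1)) t))‖ ≤ C * ((1 / 2 : ℝ) ^ N) ^ θ := by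
    intro k _
    have e1 : ((2 * k : ℕ) : ℝ≥0) * (1 / 2) ^ (N + 1) = k * (1 / 2) ^ N := by
      push_cast; rw [pow_succ]; field_simp
    have e2 : ((2 * k + 1 + 1 : ℕ) : ℝ≥0) * (1 / 2) ^ (N + 1) = (k + 1 : ℕ) * (1 / 2) ^ N := by
      push_cast; rw [pow_succ]; field_simp; ring
    rw [e2, e1, ← sub_sub]
    have hle : ∀ a b : ℕ, a ≤ b →
        (a : ℝ≥0) * (1 / 2) ^ (N + 1) ≤ b * (1 / 2) ^ (N + 1) := fun a b h => by gcongr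
    have l1 := hle _ _ (Nat.le_succ (2 * k))
    have l2 := hle _ _ (Nat.le_succ (2 * k + 1))
    rw [e1] at l1
    simp only [Nat.succ_eq_add_one] at l2
    rw [e2] at l2
    refine (hΞ _ _ _ (min_le_min_right _ l1) (min_le_min_right _ l2)).trans ?_
    refine mul_le_mul_of_nonneg_left (Real.rpow_le_rpow ?_ ?_ (by linarith)) hC
    · exact sub_nonneg.2 (by exact_mod_cast min_le_min_right t (l1.trans l2))
    · refine (min_sub_min_le t (l1.trans l2)).trans (le_of_eq ?_)
      push_cast; ring
  refine (norm_sum_le_of_le _ hterm).trans (le_of_eq ?_)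
  rw [Finset.sum_const, Finset.card_range, nsmul_eq_mul, Real.rpow_sub (by norm_num),
    ← Real.rpow_natCast (2 ^ (1 : ℝ) / 2 ^ θ), Real.div_rpow (by positivity) (by positivity),
    ← Real.rpow_natCast (1 / 2), ← Real.rpow_mul (by norm_num), ← Real.rpow_mul (by norm_num),
    ← Real.rpow_mul (by norm_num), one_div, Real.inv_rpow (by norm_num)]
  push_cast
  rw [one_mul, Real.rpow_natCast, mul_comm θ]
  field_simp

lemma AlmostAdditive.norm_dyadicSum_sub_le (hΞ : AlmostAdditive Ξ C θ) (hθ : 1 < θ) (hC : 0 ≤ C)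
    (M N : ℕ) {u v : ℝ≥0} (huv : u ≤ v) (hv : v ≤ M) :
    ‖dyadicSum Ξ M N v - dyadicSum Ξ M N u - Ξ u v‖
      ≤ C * ((1 / 2 : ℝ) ^ N) ^ θ + sewingConst C θ * ((v : ℝ) - u) ^ θ := by
  set h : ℝ≥0 := (1 / 2) ^ N with hh
  have hpos : 0 < h := by positivity
  let x : ℕ → ℝ≥0 := fun k => max u (min (k * h) v)
  have hx : Monotone x := fun a b hab => max_le_max le_rfl (min_le_min_right _ (by gcongr))
  have hmax := hΞ.norm_sum_sub_le hθ hC (M * 2 ^ N) hx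
  have x0 : x 0 = u := by simp [x]
  have xn : x (M * 2 ^ N) = v := by
    have : ((M * 2 ^ N : ℕ) : ℝ≥0) * h = M := by
      rw [hh]; push_cast; rw [mul_assoc, ← mul_pow]; simp
    simp only [x]
    rw [this, min_eq_right hv, max_eq_right huv]
  rw [x0, xn] at hmax
  let d : ℕ → E := fun k => Ξ (min (k * h) v) (min ((k + 1 : ℕ) * h) v)
    - Ξ (min (k * h) u) (min ((k + 1 : ℕ) * h) u) - Ξ (x k) (x (k + 1))
  have hself := hΞ.self_eq_zero hθ
  have hmono : ∀ k : ℕ, (k : ℝ≥0) * h ≤ (k + 1 : ℕ) * h := fun k => by gcongr; simp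
  -- only the grid cell that contains `u` contributes
  have hd0 : ∀ k : ℕ, (u ≤ k * h ∨ (k + 1 : ℕ) * h ≤ u) → d k = 0 := by
    intro k hk
    rcases hk with hk | hk
    · have h1 := hk.trans (hmono k)
      simp only [d, x]
      rw [min_eq_right hk, min_eq_right h1, hself, max_eq_right (le_min hk huv),
        max_eq_right (le_min h1 huv)]
      simp
    · have h1 := (hmono k).trans hk
      simp only [d, x]
      rw [min_eq_left hk, min_eq_left h1, min_eq_left (hk.trans huv), min_eq_left (h1.trans huv),
        max_eq_left hk, max_eq_left h1, hself]
      simp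
  have hd : ∀ k : ℕ, ‖d k‖ ≤ C * ((1 / 2 : ℝ) ^ N) ^ θ := by
    intro k
    by_cases hk : u ≤ k * h ∨ (k + 1 : ℕ) * h ≤ u
    · rw [hd0 k hk, norm_zero]; positivity
    · push Not at hk
      have e1 : min (k * h) v = min (k * h) u := by
        rw [min_eq_left hk.1.le, min_eq_left (hk.1.le.trans huv)]
      have e2 : x k = u := by simp only [x]; rw [e1, min_eq_left hk.1.le, max_eq_left hk.1.le]
      have e3 : x (k + 1) = min ((k + 1 : ℕ) * h) v := max_eq_right (le_min hk.2.le huv)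
      simp only [d]
      rw [e1, e2, e3, min_eq_right hk.2.le]
      refine (hΞ _ _ _ (min_le_right _ _) (le_min hk.2.le huv)).trans ?_
      rw [← e1]
      refine mul_le_mul_of_nonneg_left (Real.rpow_le_rpow ?_ ?_ (by linarith)) hC
      · exact sub_nonneg.2 (by exact_mod_cast min_le_min_right v (hmono k))
      · refine (min_sub_min_le v (hmono k)).trans (le_of_eq ?_)
        push_cast [hh]; ring
  have hsum : ‖∑ k ∈ Finset.range (M * 2 ^ N), d k‖ ≤ C * ((1 / 2 : ℝ) ^ N) ^ θ := by
    by_cases hex : ∃ k ∈ Finset.range (M * 2 ^ N), d k ≠ 0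
    · obtain ⟨k, hk, hk0⟩ := hex
      have hk1 := mt (hd0 k) hk0
      push Not at hk1
      rw [Finset.sum_eq_single_of_mem k hk]
      · exact hd k
      · intro j _ hjk
        by_contra hj0
        have hj1 := mt (hd0 j) hj0
        push Not at hj1
        have l1 := lt_of_mul_lt_mul_right' (hj1.1.trans hk1.2)
        have l2 := lt_of_mul_lt_mul_right' (hk1.1.trans hj1.2)
        rw [Nat.cast_lt] at l1 l2
        omega
    · push Not at hex
      rw [Finset.sum_eq_zero hex, norm_zero]
      positivity
  have e : dyadicSum Ξ M N v - dyadicSum Ξ M N u - Ξ u v = ∑ k ∈ Finset.range (M * 2 ^ N), d k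
      + (∑ k ∈ Finset.range (M * 2 ^ N), Ξ (x k) (x (k + 1)) - Ξ u v) := by
    simp only [d, Finset.sum_sub_distrib, dyadicSum, ← hh]
    abel
  rw [e]
  exact (norm_add_le _ _).trans (add_le_add hsum hmax)

/-- The sewing lemma: an almost additive `Ξ` of order `θ > 1` is close to the increments of a
path. -/
theorem AlmostAdditive.exists_path [CompleteSpace E] (hΞ : AlmostAdditive Ξ C θ) (hθ : 1 < θ)
    (hC : 0 ≤ C) (T : ℝ≥0) : ∃ I : ℝ≥0 → E, ∀ u v, u ≤ v → v ≤ T →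
      ‖I v - I u - Ξ u v‖ ≤ sewingConst C θ * ((v : ℝ) - u) ^ θ := by
  obtain ⟨M, hM⟩ := exists_nat_ge T
  have hr := two_rpow_one_sub_lt_one hθ
  have hlim : ∀ t, ∃ y, Filter.Tendsto (fun N => dyadicSum Ξ M N t) Filter.atTop (nhds y) :=
    fun t => cauchySeq_tendsto_of_complete
      (cauchySeq_of_le_geometric _ _ hr fun N => hΞ.dist_dyadicSum_succ_le hθ hC M N t)
  choose I hI using hlim
  refine ⟨I, fun u v huv hv => ?_⟩
  have h1 : Filter.Tendsto (fun N : ℕ => C * ((1 / 2 : ℝ) ^ N) ^ θ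
      + sewingConst C θ * ((v : ℝ) - u) ^ θ) Filter.atTop
      (nhds (C * 0 ^ θ + sewingConst C θ * ((v : ℝ) - u) ^ θ)) :=
    (((tendsto_pow_atTop_nhds_zero_of_lt_one (by norm_num) (by norm_num)).rpow_const
      (Or.inr (by linarith))).const_mul C).add_const _
  rw [Real.zero_rpow (by linarith), mul_zero, zero_add] at h1
  exact le_of_tendsto_of_tendsto' (((hI v).sub (hI u)).sub_const _).norm h1
    fun N => hΞ.norm_dyadicSum_sub_le hθ hC M N huv (hv.trans hM)

end Sewing

/-! ### The Young integral in a Banach space -/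

section AbstractYoung

variable {E : Type*} [NormedAddCommGroup E]

/-- The data of a Young integral `∫ F dg` with values in a normed space: `Z ξ u v` stands for
`F_ξ (g_v - g_u)`, additive in the interval `[u, v]`, of size `(v - u)^β`, and varying with the
tag `ξ` by an amount of order `θ`. -/
structure IsYoungGerm (T : ℝ≥0) (Z : ℝ≥0 → ℝ≥0 → ℝ≥0 → E) (C θ M β : ℝ) : Prop where
  one_lt : 1 < θ
  pos : 0 < β
  C_nonneg : 0 ≤ C
  M_nonneg : 0 ≤ M
  additive : ∀ ξ u v w, Z ξ u w = Z ξ u v + Z ξ v w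
  tag : ∀ lo hi ξ ξ' u v : ℝ≥0, ξ ∈ Set.Icc lo hi → ξ' ∈ Set.Icc lo hi → lo ≤ u → u ≤ v → v ≤ hi →
    ‖Z ξ u v - Z ξ' u v‖ ≤ C * ((hi : ℝ) - lo) ^ θ
  size : ∀ ξ u v : ℝ≥0, ξ ≤ T → u ≤ v → v ≤ T → ‖Z ξ u v‖ ≤ M * ((v : ℝ) - u) ^ β

variable {T : ℝ≥0} {Z : ℝ≥0 → ℝ≥0 → ℝ≥0 → E} {C θ M β : ℝ}

/-- `I` is an indefinite Young integral on `[0, T]`. -/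
def IsYoungPath (T : ℝ≥0) (Z : ℝ≥0 → ℝ≥0 → ℝ≥0 → E) (K θ : ℝ) (I : ℝ≥0 → E) : Prop :=
  ∀ ξ u v : ℝ≥0, u ≤ ξ → ξ ≤ v → v ≤ T → ‖Z ξ u v - (I v - I u)‖ ≤ K * ((v : ℝ) - u) ^ θ

lemma IsYoungGerm.exists_path [CompleteSpace E] (hZ : IsYoungGerm T Z C θ M β) :
    ∃ K, 0 ≤ K ∧ ∃ I, IsYoungPath T Z K θ I := by
  have hΞ : AlmostAdditive (fun u v => Z u u v) C θ := fun u v w huv hvw => by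
    have := hZ.tag u w u v v w ⟨le_rfl, huv.trans hvw⟩ ⟨huv, hvw⟩ huv hvw le_rfl
    change ‖Z u u w - Z u u v - Z v v w‖ ≤ _
    rwa [hZ.additive u u v w, add_sub_cancel_left]
  obtain ⟨I, hI⟩ := hΞ.exists_path hZ.one_lt hZ.C_nonneg T
  refine ⟨C + sewingConst C θ, add_nonneg hZ.C_nonneg (sewingConst_nonneg hZ.one_lt hZ.C_nonneg), I,
    fun ξ u v hu hv hvT => ?_⟩
  have huv := hu.trans hv
  have h1 := hZ.tag u v ξ u u v ⟨hu, hv⟩ ⟨le_rfl, huv⟩ le_rfl huv le_rfl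
  have h2 := hI u v huv hvT
  have e : Z ξ u v - (I v - I u) = (Z ξ u v - Z u u v) - (I v - I u - Z u u v) := by abel
  rw [e, add_mul]
  exact (norm_sub_le _ _).trans (add_le_add h1 h2)

lemma IsYoungPath.norm_sub_le {K : ℝ} {I : ℝ≥0 → E} (hZ : IsYoungGerm T Z C θ M β)
    (hI : IsYoungPath T Z K θ I) {u v : ℝ≥0} (huv : u ≤ v) (hv : v ≤ T) :
    ‖I v - I u‖ ≤ M * ((v : ℝ) - u) ^ β + K * ((v : ℝ) - u) ^ θ := by
  have e : I v - I u = Z u u v - (Z u u v - (I v - I u)) := by abel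
  rw [e]
  exact (_root_.norm_sub_le _ _).trans
    (add_le_add (hZ.size u u v (huv.trans hv) huv hv) (hI u u v le_rfl huv hv))

/-- Clamping to an interval `[a, b]` does not increase distances. -/
lemma max_min_sub_max_min_le {a b u v : ℝ≥0} (huv : u ≤ v) :
    (max a (min v b) : ℝ≥0) - ((max a (min u b) : ℝ≥0) : ℝ) ≤ v - u := by
  have h1 := min_sub_min_le b huv
  have h2 : (min u b : ℝ≥0) ≤ min v b := min_le_min_right _ huv
  have h2' : ((min u b : ℝ≥0) : ℝ) ≤ (min v b : ℝ≥0) := by exact_mod_cast h2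
  rw [NNReal.coe_max, NNReal.coe_max]
  rcases le_total (a : ℝ) (min u b : ℝ≥0) with h | h
  · rw [max_eq_right h, max_eq_right (h.trans h2')]; exact h1
  · rw [max_eq_left h]
    rcases le_total (a : ℝ) (min v b : ℝ≥0) with h' | h'
    · rw [max_eq_right h']; linarith
    · rw [max_eq_left h']; linarith

lemma TaggedPartition.sum_increments {G : Type*} [AddCommGroup G] (π : TaggedPartition T)
    (f : ℝ≥0 → G) : ∑ i : Fin π.m, (f (π.pt i.succ) - f (π.pt i.castSucc)) = f T - f 0 := by
  have h := Fin.sum_univ_succ (fun i => f (π.pt i))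
  rw [Fin.sum_univ_castSucc] at h
  rw [Finset.sum_sub_distrib, sub_eq_sub_iff_add_eq_add, add_comm, ← π.pt_zero, ← h, π.pt_last,
    add_comm]

/-- A point lies in at most two closed cells of a partition. -/
lemma TaggedPartition.card_cells_le_two (π : TaggedPartition T) (a : ℝ≥0) :
    (Finset.univ.filter fun i : Fin π.m => π.pt i.castSucc ≤ a ∧ a ≤ π.pt i.succ).card ≤ 2 := by
  by_contra hcard
  obtain ⟨i, hi, j, hj, k, hk, hij, hik, hjk⟩ := Finset.two_lt_card.1 (not_le.1 hcard)
  simp only [Finset.mem_filter, Finset.mem_univ, true_and] at hi hj hk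
  have key : ∀ p q : Fin π.m, π.pt p.castSucc ≤ a → a ≤ π.pt q.succ → (p : ℕ) ≤ q + 1 := by
    intro p q hp hq
    have := π.strictMono.le_iff_le.1 (hp.trans hq)
    simpa [Fin.le_def] using this
  have := key i j hi.1 hj.2
  have := key i k hi.1 hk.2
  have := key j i hj.1 hi.2
  have := key j k hj.1 hk.2
  have := key k i hk.1 hi.2
  have := key k j hk.1 hj.2
  rw [ne_eq, Fin.ext_iff] at hij hik hjk
  omega

open Classical in
/-- The error of one cell of a Riemann–Stieltjes sum of `F` restricted to `[a, b]`: the cells that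
contain an endpoint `a` or `b` contribute to a lower order. -/
lemma IsYoungPath.norm_cell_le {K : ℝ} {I : ℝ≥0 → E} (hK : 0 ≤ K) (hZ : IsYoungGerm T Z C θ M β)
    (hI : IsYoungPath T Z K θ I) {a b : ℝ≥0} (hab : a ≤ b) (hb : b ≤ T) {ξ u v : ℝ≥0}
    (hξ : ξ ∈ Set.Icc u v) (hv : v ≤ T) :
    ‖(if ξ ∈ Set.Icc a b then Z ξ u v else 0) - (I (max a (min v b)) - I (max a (min u b)))‖
      ≤ 2 * K * ((v : ℝ) - u) ^ θ + ((if u ≤ a ∧ a ≤ v then 1 else 0)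
        + if u ≤ b ∧ b ≤ v then 1 else 0) * (2 * M * ((v : ℝ) - u) ^ β) := by
  have huv : u ≤ v := hξ.1.trans hξ.2
  have huv' : (0 : ℝ) ≤ (v : ℝ) - u := sub_nonneg.2 (by exact_mod_cast huv)
  have hM := hZ.M_nonneg
  have hcl := max_min_sub_max_min_le (a := a) (b := b) huv
  have hclmono : max a (min u b) ≤ max a (min v b) := max_le_max le_rfl (min_le_min_right _ huv)
  have hclT : max a (min v b) ≤ T := max_le (hab.trans hb) ((min_le_right _ _).trans hb)
  have hcl0 : (0 : ℝ) ≤ (max a (min v b) : ℝ≥0) - ((max a (min u b) : ℝ≥0) : ℝ) :=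
    sub_nonneg.2 (by exact_mod_cast hclmono)
  have hθ0 : 0 ≤ ((v : ℝ) - u) ^ θ := Real.rpow_nonneg huv' _
  have hβ0 : 0 ≤ ((v : ℝ) - u) ^ β := Real.rpow_nonneg huv' _
  by_cases hin : a ≤ u ∧ v ≤ b
  · rw [if_pos ⟨hin.1.trans hξ.1, hξ.2.trans hin.2⟩, min_eq_left hin.2,
      min_eq_left (huv.trans hin.2), max_eq_right hin.1, max_eq_right (hin.1.trans huv)]
    refine (hI ξ u v hξ.1 hξ.2 hv).trans ?_
    have : 0 ≤ ((if u ≤ a ∧ a ≤ v then 1 else 0)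
        + if u ≤ b ∧ b ≤ v then 1 else 0) * (2 * M * ((v : ℝ) - u) ^ β) := by positivity
    nlinarith [mul_nonneg hK hθ0]
  by_cases hout : v < a ∨ b < u
  · have e1 : ¬ ξ ∈ Set.Icc a b := by
      rintro ⟨h1, h2⟩
      rcases hout with h | h
      · exact absurd (h1.trans hξ.2) (not_le.2 h)
      · exact absurd (hξ.1.trans h2) (not_le.2 h)
    have e2 : max a (min v b) = max a (min u b) := by
      rcases hout with h | h
      · rw [max_eq_left ((min_le_left _ _).trans h.le),
          max_eq_left ((min_le_left _ _).trans (huv.trans h.le))]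
      · rw [min_eq_right h.le, min_eq_right (h.le.trans huv)]
    rw [if_neg e1, e2]
    simp only [sub_self, norm_zero]
    positivity
  push Not at hin hout
  have hone : (1 : ℝ) ≤ (if u ≤ a ∧ a ≤ v then 1 else 0) + if u ≤ b ∧ b ≤ v then 1 else 0 := by
    by_cases hau : a ≤ u
    · rw [if_pos (show u ≤ b ∧ b ≤ v from ⟨hout.2, (hin hau).le⟩)]
      have : (0 : ℝ) ≤ if u ≤ a ∧ a ≤ v then 1 else 0 := by positivity
      linarith
    · rw [if_pos (show u ≤ a ∧ a ≤ v from ⟨(not_le.1 hau).le, hout.1⟩)]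
      have : (0 : ℝ) ≤ if u ≤ b ∧ b ≤ v then 1 else 0 := by positivity
      linarith
  have hZb : ‖(if ξ ∈ Set.Icc a b then Z ξ u v else 0)‖ ≤ M * ((v : ℝ) - u) ^ β := by
    split_ifs with h
    · exact hZ.size ξ u v (hξ.2.trans hv) huv hv
    · rw [norm_zero]; positivity
  have hIb : ‖I (max a (min v b)) - I (max a (min u b))‖
      ≤ M * ((v : ℝ) - u) ^ β + K * ((v : ℝ) - u) ^ θ := by
    refine (hI.norm_sub_le hZ hclmono hclT).trans (add_le_add ?_ ?_)
    · exact mul_le_mul_of_nonneg_left (Real.rpow_le_rpow hcl0 hcl hZ.pos.le) hM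
    · exact mul_le_mul_of_nonneg_left
        (Real.rpow_le_rpow hcl0 hcl (by linarith [hZ.one_lt])) hK
  have h1 := mul_le_mul_of_nonneg_right hone
    (by positivity : 0 ≤ 2 * M * ((v : ℝ) - u) ^ β)
  refine (_root_.norm_sub_le _ _).trans ((add_le_add hZb hIb).trans ?_)
  nlinarith [mul_nonneg hK hθ0]

open Classical in
/-- Riemann–Stieltjes sums of an integrand restricted to `[a, b]` converge to the increment of the
indefinite Young integral. -/
lemma IsYoungPath.norm_rsSum_le {K : ℝ} {I : ℝ≥0 → E} (hK : 0 ≤ K) (hZ : IsYoungGerm T Z C θ M β)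
    (hI : IsYoungPath T Z K θ I) {a b : ℝ≥0} (hab : a ≤ b) (hb : b ≤ T) {δ : ℝ} (hδ : 0 < δ)
    (π : TaggedPartition T) (hπ : π.MeshLT δ) :
    ‖∑ i : Fin π.m, (if π.tag i ∈ Set.Icc a b then Z (π.tag i) (π.pt i.castSucc) (π.pt i.succ)
        else 0) - (I b - I a)‖ ≤ 2 * K * T * δ ^ (θ - 1) + 8 * M * δ ^ β := by
  have htel : I b - I a = ∑ i : Fin π.m, (I (max a (min (π.pt i.succ) b))
      - I (max a (min (π.pt i.castSucc) b))) := by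
    rw [π.sum_increments fun x => I (max a (min x b)), min_eq_right hb, max_eq_right hab]
    simp
  rw [htel, ← Finset.sum_sub_distrib]
  set D : Fin π.m → ℝ := fun i => (π.pt i.succ : ℝ) - π.pt i.castSucc
  have hD0 : ∀ i, 0 ≤ D i := fun i => sub_nonneg.2 (by exact_mod_cast π.pt_castSucc_le i)
  have hDT : ∑ i, D i = T := by
    exact (π.sum_increments (fun x => (x : ℝ))).trans (by simp)
  have hM := hZ.M_nonneg
  have hcard : ∀ c : ℝ≥0, ∑ i : Fin π.m, (if π.pt i.castSucc ≤ c ∧ c ≤ π.pt i.succ then (1 : ℝ)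
      else 0) ≤ 2 := fun c => by
    rw [Finset.sum_boole]
    exact_mod_cast π.card_cells_le_two c
  calc _ ≤ ∑ i : Fin π.m, (2 * K * (D i * δ ^ (θ - 1))
        + ((if π.pt i.castSucc ≤ a ∧ a ≤ π.pt i.succ then 1 else 0)
          + if π.pt i.castSucc ≤ b ∧ b ≤ π.pt i.succ then 1 else 0) * (2 * M * δ ^ β)) := by
        refine norm_sum_le_of_le _ fun i _ =>
          (hI.norm_cell_le hK hZ hab hb (π.tag_mem i) (π.pt_mem _).2).trans ?_
        have h1 : D i ^ θ ≤ D i * δ ^ (θ - 1) := by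
          have : D i ^ θ = D i * D i ^ (θ - 1) := by
            rw [← Real.rpow_one_add' (hD0 i) (by linarith [hZ.one_lt])]; ring_nf
          rw [this]
          exact mul_le_mul_of_nonneg_left
            (Real.rpow_le_rpow (hD0 i) (hπ i).le (by linarith [hZ.one_lt])) (hD0 i)
        have h2 : D i ^ β ≤ δ ^ β := Real.rpow_le_rpow (hD0 i) (hπ i).le hZ.pos.le
        refine add_le_add (mul_le_mul_of_nonneg_left h1 (by linarith))
          (mul_le_mul_of_nonneg_left (mul_le_mul_of_nonneg_left h2 (by linarith)) (by positivity))
    _ = 2 * K * T * δ ^ (θ - 1)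
        + (∑ i : Fin π.m, (if π.pt i.castSucc ≤ a ∧ a ≤ π.pt i.succ then (1 : ℝ) else 0)
          + ∑ i : Fin π.m, (if π.pt i.castSucc ≤ b ∧ b ≤ π.pt i.succ then (1 : ℝ) else 0))
          * (2 * M * δ ^ β) := by
        rw [Finset.sum_add_distrib, ← Finset.mul_sum, ← Finset.sum_mul, hDT, ← Finset.sum_mul,
          Finset.sum_add_distrib]
        ring
    _ ≤ 2 * K * T * δ ^ (θ - 1) + (2 + 2) * (2 * M * δ ^ β) := by
        gcongr
        · exact hcard a
        · exact hcard b
    _ = _ := by ring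

end AbstractYoung

/-! ### Existence of Riemann–Stieltjes integrals between Young regular processes -/

section Young

variable {Ω : Type*} [MeasurableSpace Ω] {P : Measure Ω}

/-- A process with finite moments of all orders that is, for every `p < ∞`, Hölder continuous in
`L_p` with an exponent above `1/2`. Any two such processes can be integrated against each other. -/
structure YoungRegular (P : Measure Ω) (F : ℝ≥0 → Ω → ℝ) : Prop where
  moments : ∀ s, HasAllMoments P (F s)
  holder : ∀ p : ℝ≥0∞, 1 ≤ p → p ≠ ∞ → ∃ α C : ℝ, 1 / 2 < α ∧ 0 ≤ C ∧ ∀ u v : ℝ≥0, u ≤ v →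
    eLpNorm (fun ω => F v ω - F u ω) p P ≤ ENNReal.ofReal (C * ((v : ℝ) - u) ^ α)

lemma YoungRegular.of_const {X : Ω → ℝ} (hX : HasAllMoments P X) : YoungRegular P (fun _ => X) :=
  ⟨fun _ => hX, fun p _ _ => ⟨1, 0, by norm_num, le_rfl, fun u v _ => by simp⟩⟩

lemma YoungRegular.exists_bound [IsProbabilityMeasure P] {F : ℝ≥0 → Ω → ℝ} (hF : YoungRegular P F)
    (T : ℝ≥0) {p : ℝ≥0∞} (hp : 1 ≤ p) (hp' : p ≠ ∞) :
    ∃ M : ℝ, 0 ≤ M ∧ ∀ s ≤ T, eLpNorm (F s) p P ≤ ENNReal.ofReal M := by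
  obtain ⟨α, C, hα, hC, h⟩ := hF.holder p hp hp'
  have h0 : eLpNorm (F 0) p P ≠ ∞ := (hF.moments 0 p hp').2.ne
  refine ⟨(eLpNorm (F 0) p P).toReal + C * (T : ℝ) ^ α, by positivity, fun s hs => ?_⟩
  have e : F s = F 0 + fun ω => F s ω - F 0 ω := by ext ω; simp
  rw [e, ENNReal.ofReal_add (by positivity) (by positivity), ENNReal.ofReal_toReal h0]
  refine (eLpNorm_add_le (hF.moments 0 p hp').1 (((hF.moments s).sub (hF.moments 0)) p hp').1
    hp).trans (add_le_add le_rfl ((h 0 s zero_le).trans (ENNReal.ofReal_le_ofReal ?_)))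
  have : (s : ℝ) ≤ T := by exact_mod_cast hs
  simp only [NNReal.coe_zero, sub_zero]
  gcongr

variable [IsProbabilityMeasure P] {G g : ℝ≥0 → Ω → ℝ}

/-- The Young germ `G_ξ (g_v - g_u)` in the space `L_p`. -/
noncomputable def youngGerm (hG : YoungRegular P G) (hg : YoungRegular P g) {p : ℝ≥0∞}
    (hp' : p ≠ ∞) (ξ u v : ℝ≥0) : Lp ℝ p P :=
  (((hG.moments ξ).mul ((hg.moments v).sub (hg.moments u))) p hp').toLp
    (fun ω => G ξ ω * (g v ω - g u ω))

/-- The order `θ` of the germ is the sum of the Hölder exponents `α` of `G` and `β` of `g` in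
`L_{2p}`; it exceeds `1`. -/
lemma isYoungGerm_youngGerm (hG : YoungRegular P G) (hg : YoungRegular P g) (T : ℝ≥0)
    {p : ℝ≥0∞} [Fact (1 ≤ p)] (hp' : p ≠ ∞) :
    ∃ C θ M β α : ℝ, 1 / 2 < β ∧ 0 ≤ α ∧ θ = α + β ∧
      IsYoungGerm T (youngGerm hG hg hp') C θ M β := by
  have hp : 1 ≤ p := Fact.out
  have h2p : 1 ≤ 2 * p := hp.trans (le_mul_of_one_le_left' one_le_two)
  have h2p' : 2 * p ≠ ∞ := ENNReal.mul_ne_top (by simp) hp'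
  obtain ⟨α, C₁, hα, hC₁, h₁⟩ := hG.holder _ h2p h2p'
  obtain ⟨β, C₂, hβ, hC₂, h₂⟩ := hg.holder _ h2p h2p'
  obtain ⟨M, hM, hGM⟩ := hG.exists_bound T h2p h2p'
  refine ⟨C₁ * C₂, α + β, M * C₂, β, α, hβ, by linarith, rfl, by linarith, by linarith,
    by positivity, by positivity, fun ξ u v w => ?_, ?_, fun ξ u v hξ huv hv => ?_⟩
  · rw [youngGerm, youngGerm, youngGerm, ← MemLp.toLp_add]
    congr 1
    ext ω
    simp only [Pi.add_apply]
    ring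
  · have key : ∀ lo hi ξ ξ' u v : ℝ≥0, ξ ∈ Set.Icc lo hi → ξ' ∈ Set.Icc lo hi → lo ≤ u → u ≤ v →
        v ≤ hi → ξ' ≤ ξ → ‖youngGerm hG hg hp' ξ u v - youngGerm hG hg hp' ξ' u v‖
          ≤ C₁ * C₂ * ((hi : ℝ) - lo) ^ (α + β) := by
      intro lo hi ξ ξ' u v hξ hξ' hu huv hv hle
      have c1 : (lo : ℝ) ≤ ξ' := by exact_mod_cast hξ'.1
      have c2 : (ξ : ℝ) ≤ hi := by exact_mod_cast hξ.2
      have c3 : (lo : ℝ) ≤ u := by exact_mod_cast hu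
      have c4 : (v : ℝ) ≤ hi := by exact_mod_cast hv
      have c5 : (ξ' : ℝ) ≤ ξ := by exact_mod_cast hle
      have c6 : (u : ℝ) ≤ v := by exact_mod_cast huv
      have hL : 0 ≤ (hi : ℝ) - lo := by linarith
      rw [youngGerm, youngGerm, ← MemLp.toLp_sub, Lp.norm_toLp]
      refine ENNReal.toReal_le_of_le_ofReal (by positivity) ?_
      have e : ((fun ω => G ξ ω * (g v ω - g u ω)) - fun ω => G ξ' ω * (g v ω - g u ω))
          = fun ω => (G ξ ω - G ξ' ω) * (g v ω - g u ω) := by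
        ext ω; simp only [Pi.sub_apply]; ring
      rw [e]
      refine (eLpNorm_mul_le_two_mul ((hG.moments _).sub (hG.moments _))
        ((hg.moments _).sub (hg.moments _)) hp').trans ((mul_le_mul' (h₁ _ _ hle)
          (h₂ _ _ huv)).trans ?_)
      rw [← ENNReal.ofReal_mul (by
        have : 0 ≤ (ξ : ℝ) - ξ' := by linarith
        positivity)]
      refine ENNReal.ofReal_le_ofReal ?_
      rw [Real.rpow_add_of_nonneg hL (by linarith) (by linarith)]
      calc _ ≤ C₁ * ((hi : ℝ) - lo) ^ α * (C₂ * ((hi : ℝ) - lo) ^ β) := by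
            have d1 : 0 ≤ (ξ : ℝ) - ξ' := by linarith
            have d2 : 0 ≤ (v : ℝ) - u := by linarith
            gcongr
        _ = _ := by ring
    intro lo hi ξ ξ' u v hξ hξ' hu huv hv
    rcases le_total ξ' ξ with h | h
    · exact key lo hi ξ ξ' u v hξ hξ' hu huv hv h
    · rw [norm_sub_rev]
      exact key lo hi ξ' ξ u v hξ' hξ hu huv hv h
  · have c : (0 : ℝ) ≤ (v : ℝ) - u := sub_nonneg.2 (by exact_mod_cast huv)
    rw [youngGerm, Lp.norm_toLp]
    refine ENNReal.toReal_le_of_le_ofReal (by positivity) ?_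
    refine (eLpNorm_mul_le_two_mul (hG.moments _) ((hg.moments _).sub (hg.moments _)) hp').trans
      ((mul_le_mul' (hGM _ hξ) (h₂ _ _ huv)).trans (le_of_eq ?_))
    rw [← ENNReal.ofReal_mul hM, mul_assoc]

open Classical in
/-- The indefinite Young integral in one fixed `L_p`. -/
lemma exists_young_path (hG : YoungRegular P G) (hg : YoungRegular P g) {a T : ℝ≥0}
    {p : ℝ≥0∞} (hp : 1 ≤ p) (hp' : p ≠ ∞) :
    ∃ Y : ℝ≥0 → Ω → ℝ, (∀ s, MemLp (Y s) p P) ∧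
      (∃ α C : ℝ, 1 / 2 < α ∧ 0 ≤ C ∧ ∀ u v : ℝ≥0, u ≤ v → v ≤ T →
        eLpNorm (fun ω => Y v ω - Y u ω) p P ≤ ENNReal.ofReal (C * ((v : ℝ) - u) ^ α)) ∧
      ∀ b ∈ Set.Icc a T,
        RSConverges P T p (fun s => if s ∈ Set.Icc a b then G s else fun _ => 0) g (Y b) := by
  have : Fact (1 ≤ p) := ⟨hp⟩
  obtain ⟨C, θ, M, β, α, hβ, hα, hθ, hZ⟩ := isYoungGerm_youngGerm hG hg T hp'
  obtain ⟨K, hK, I, hI⟩ := hZ.exists_path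
  have hM := hZ.M_nonneg
  refine ⟨fun s => ⇑(I s - I a), fun s => Lp.memLp _, ⟨β, M + K * (T : ℝ) ^ α, hβ, by positivity,
    fun u v huv hv => ?_⟩, fun b hb ε hε => ?_⟩
  · have c : (0 : ℝ) ≤ (v : ℝ) - u := sub_nonneg.2 (by exact_mod_cast huv)
    have c' : (v : ℝ) - u ≤ T := by
      have h1 : (v : ℝ) ≤ T := by exact_mod_cast hv
      linarith [u.2]
    have e : (fun ω => (I v - I a : Lp ℝ p P) ω - (I u - I a : Lp ℝ p P) ω)
        =ᵐ[P] ⇑(I v - I u) := by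
      filter_upwards [Lp.coeFn_sub (I v) (I a), Lp.coeFn_sub (I u) (I a),
        Lp.coeFn_sub (I v) (I u)] with ω h1 h2 h3
      rw [h1, h2, h3]
      simp
    rw [eLpNorm_congr_ae e, ← Lp.enorm_def, ← ofReal_norm]
    refine ENNReal.ofReal_le_ofReal ((hI.norm_sub_le hZ huv hv).trans ?_)
    rw [hθ, Real.rpow_add_of_nonneg c hα (by linarith), add_mul, mul_assoc]
    gcongr
  · have hlim : Filter.Tendsto (fun δ : ℝ => 2 * K * T * δ ^ (θ - 1) + 8 * M * δ ^ β)
        (nhdsWithin 0 (Set.Ioi 0)) (nhds 0) := by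
      have h1 : Filter.Tendsto (fun δ : ℝ => 2 * K * T * δ ^ (θ - 1) + 8 * M * δ ^ β) (nhds 0)
          (nhds (2 * K * T * 0 ^ (θ - 1) + 8 * M * 0 ^ β)) :=
        ((Filter.tendsto_id.rpow_const (Or.inr (by linarith [hZ.one_lt]))).const_mul _).add
          ((Filter.tendsto_id.rpow_const (Or.inr hZ.pos.le)).const_mul _)
      rw [Real.zero_rpow (by linarith [hZ.one_lt]), Real.zero_rpow hZ.pos.ne'] at h1
      simp only [mul_zero, add_zero] at h1
      exact h1.mono_left nhdsWithin_le_nhds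
    have hev := (ENNReal.tendsto_ofReal hlim).eventually (gt_mem_nhds (by simpa using hε))
    obtain ⟨δ, hδ, hδ0⟩ := (hev.and self_mem_nhdsWithin).exists
    refine ⟨δ, hδ0, fun π hπ => ?_⟩
    set s : Lp ℝ p P := ∑ i : Fin π.m, if π.tag i ∈ Set.Icc a b then
      youngGerm hG hg hp' (π.tag i) (π.pt i.castSucc) (π.pt i.succ) else 0 with hs
    have hcell : ∀ᵐ ω ∂P, ∀ i : Fin π.m, (if π.tag i ∈ Set.Icc a b then
        youngGerm hG hg hp' (π.tag i) (π.pt i.castSucc) (π.pt i.succ) else 0 : Lp ℝ p P) ω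
        = (if π.tag i ∈ Set.Icc a b then G (π.tag i) else fun _ => 0) ω
          * (g (π.pt i.succ) ω - g (π.pt i.castSucc) ω) := by
      refine ae_all_iff.2 fun i => ?_
      split_ifs
      · exact MemLp.coeFn_toLp _
      · filter_upwards [Lp.coeFn_zero ℝ p P] with ω hω
        rw [hω, Pi.zero_apply, zero_mul]
    have e : (fun ω => π.rsSum (fun s => if s ∈ Set.Icc a b then G s else fun _ => 0) g ω
        - (I b - I a : Lp ℝ p P) ω) =ᵐ[P] ⇑(s - (I b - I a)) := by
      filter_upwards [hcell, Lp.coeFn_sub s (I b - I a), Lp.coeFn_fun_finsetSum Finset.univ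
        (fun i : Fin π.m => (if π.tag i ∈ Set.Icc a b then
          youngGerm hG hg hp' (π.tag i) (π.pt i.castSucc) (π.pt i.succ) else 0 : Lp ℝ p P))]
        with ω h1 h2 h3
      rw [h2, Pi.sub_apply, hs, h3]
      simp only [h1]
      rfl
    rw [eLpNorm_congr_ae e, ← Lp.enorm_def, ← ofReal_norm]
    exact (ENNReal.ofReal_le_ofReal (hI.norm_rsSum_le hK hZ hb.1 hb.2 hδ0 π hπ)).trans_lt hδ

lemma RSConverges.of_exponent_le {T : ℝ≥0} {p q : ℝ≥0∞} (hpq : p ≤ q) {f : ℝ≥0 → Ω → ℝ} {Y : Ω → ℝ}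
    (hq : q ≠ ∞) (hf : ∀ s ∈ Set.Icc 0 T, HasAllMoments P (f s)) (hg : ∀ s, HasAllMoments P (g s))
    (hY : MemLp Y q P) (h : RSConverges P T q f g Y) : RSConverges P T p f g Y := fun ε hε => by
  obtain ⟨δ, hδ, H⟩ := h ε hε
  exact ⟨δ, hδ, fun π hπ => (eLpNorm_le_eLpNorm_of_exponent_le hpq
    ((π.hasAllMoments_rsSum hf hg q hq).sub hY).1).trans_lt (H π hπ)⟩

open Classical in
/-- Indefinite Young integrals between Young regular processes exist, and are Young regular. -/
theorem exists_young_integral (hG : YoungRegular P G) (hg : YoungRegular P g) {a T : ℝ≥0}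
    (haT : a ≤ T) : ∃ Y : ℝ≥0 → Ω → ℝ, YoungRegular P Y ∧ ∀ b ∈ Set.Icc a T,
      HasRSIntegral P T (fun s => if s ∈ Set.Icc a b then G s else fun _ => 0) g (Y b) := by
  choose Y hYmem hYholder hYconv using fun p : {p : ℝ≥0∞ // 1 ≤ p ∧ p ≠ ∞} =>
    exists_young_path (a := a) (T := T) hG hg p.2.1 p.2.2
  let one : {p : ℝ≥0∞ // 1 ≤ p ∧ p ≠ ∞} := ⟨1, le_rfl, by simp⟩
  have hmom : ∀ b, ∀ s ∈ Set.Icc 0 T,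
      HasAllMoments P (if s ∈ Set.Icc a b then G s else fun _ => 0) := fun b s _ => by
    split_ifs
    · exact hG.moments s
    · exact .const 0
  -- limits in different `L_p` agree almost surely
  have hae : ∀ p, ∀ b ∈ Set.Icc a T, Y p b =ᵐ[P] Y one b := fun p b hb =>
    RSConverges.ae_unique le_rfl (by simp) (hmom b) hg.moments (fun s _ => .rfl)
      ((hYmem p b).mono_exponent p.2.1) (hYmem one b)
      ((hYconv p b hb).of_exponent_le p.2.1 p.2.2 (hmom b) hg.moments (hYmem p b))
      (hYconv one b hb)
  have hcl : ∀ s, max a (min s T) ∈ Set.Icc a T := fun s =>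
    ⟨le_max_left _ _, max_le haT (min_le_right _ _)⟩
  have hYmom : ∀ b ∈ Set.Icc a T, HasAllMoments P (Y one b) := fun b hb =>
    .of_one_le fun p hp hp' => (memLp_congr_ae (hae ⟨p, hp, hp'⟩ b hb)).1 (hYmem ⟨p, hp, hp'⟩ b)
  refine ⟨fun s => Y one (max a (min s T)), ⟨fun s => hYmom _ (hcl s), fun p hp hp' => ?_⟩,
    fun b hb p hp hp' => ?_⟩
  · obtain ⟨α, C, hα, hC, h⟩ := hYholder ⟨p, hp, hp'⟩
    refine ⟨α, C, hα, hC, fun u v huv => ?_⟩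
    have e : (fun ω => Y one (max a (min v T)) ω - Y one (max a (min u T)) ω)
        =ᵐ[P] fun ω => Y ⟨p, hp, hp'⟩ (max a (min v T)) ω
          - Y ⟨p, hp, hp'⟩ (max a (min u T)) ω := by
      filter_upwards [hae ⟨p, hp, hp'⟩ _ (hcl u), hae ⟨p, hp, hp'⟩ _ (hcl v)] with ω h1 h2
      rw [h1, h2]
    have hle : max a (min u T) ≤ max a (min v T) := max_le_max le_rfl (min_le_min_right _ huv)
    rw [eLpNorm_congr_ae e]
    refine (h _ _ hle (hcl v).2).trans (ENNReal.ofReal_le_ofReal ?_)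
    refine mul_le_mul_of_nonneg_left (Real.rpow_le_rpow
      (sub_nonneg.2 (by exact_mod_cast hle)) ?_ (by linarith)) hC
    exact max_min_sub_max_min_le huv
  · have hbb : max a (min b T) = b := by rw [min_eq_left hb.2, max_eq_right hb.1]
    simp only [hbb]
    refine ⟨hYmom b hb p hp', fun ε hε => ?_⟩
    obtain ⟨δ, hδ, H⟩ := hYconv ⟨p, hp, hp'⟩ b hb ε hε
    refine ⟨δ, hδ, fun π hπ => ?_⟩
    rw [eLpNorm_congr_ae]
    · exact H π hπ
    · filter_upwards [hae ⟨p, hp, hp'⟩ b hb] with ω hω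
      rw [hω]

end Young

/-! ### Existence of multiple integrals over unions of simplices and cubes -/

section MultipleExistence

variable {Ω : Type*} [MeasurableSpace Ω] {P : Measure Ω} [IsProbabilityMeasure P] {T : ℝ≥0}

lemma orderedSimplex_section {r : ℕ} {a b s : ℝ≥0} (hs : s ∈ Set.Icc a b) :
    {x : Fin r → ℝ≥0 | (Fin.snoc x s : Fin (r + 1) → ℝ≥0) ∈ orderedSimplex (r + 1) a b}
      = orderedSimplex r a s := by
  ext x
  constructor
  · rintro ⟨hmono, hmem⟩
    refine ⟨fun i j hij => ?_, fun i => ⟨?_, ?_⟩⟩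
    · simpa using hmono (Fin.castSucc_le_castSucc_iff.2 hij)
    · simpa using (hmem i.castSucc).1
    · simpa using hmono (Fin.le_last i.castSucc)
  · rintro ⟨hmono, hmem⟩
    refine ⟨fun i j hij => ?_, fun i => ?_⟩
    · induction j using Fin.lastCases with
      | last =>
        induction i using Fin.lastCases with
        | last => exact le_rfl
        | cast i => simpa using (hmem i).2
      | cast j =>
        induction i using Fin.lastCases with
        | last => exact absurd hij (not_le.2 (Fin.castSucc_lt_last j))
        | cast i => simpa using hmono (Fin.castSucc_le_castSucc_iff.1 hij)
    · induction i using Fin.lastCases with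
      | last => simpa using hs
      | cast i => simpa using Set.mem_Icc.1 ⟨(hmem i).1, (hmem i).2.trans hs.2⟩

lemma cube_section {r : ℕ} {a b s : ℝ≥0} (hs : s ∈ Set.Icc a b) :
    {x : Fin r → ℝ≥0 | (Fin.snoc x s : Fin (r + 1) → ℝ≥0) ∈ cube (r + 1) a b} = cube r a b := by
  ext x
  constructor
  · intro h i
    simpa using h i.castSucc
  · intro h i
    induction i using Fin.lastCases with
    | last => simpa using hs
    | cast i => simpa using h i

lemma orderedSimplex_subset_cube (r : ℕ) (a b : ℝ≥0) : orderedSimplex r a b ⊆ cube r a b :=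
  fun _ hx => hx.2

lemma cube_section_eq_empty {r : ℕ} {a b s : ℝ≥0} (hs : s ∉ Set.Icc a b)
    {A : Set (Fin (r + 1) → ℝ≥0)}
    (hA : A ⊆ cube (r + 1) a b) :
    {x : Fin r → ℝ≥0 | (Fin.snoc x s : Fin (r + 1) → ℝ≥0) ∈ A} = ∅ :=
  Set.eq_empty_of_forall_notMem fun x hx => hs (by simpa using hA hx (Fin.last r))

/-- The iterated integral over the simplex `a ≤ s_1 ≤ ⋯ ≤ s_r ≤ s` exists and is Young regular as
a process in the upper endpoint `s`, which is what makes the next integration possible. -/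
lemma exists_hasMultipleIntegral_orderedSimplex {a : ℝ≥0} (haT : a ≤ T) {r : ℕ}
    {B : Fin r → ℝ≥0 → Ω → ℝ} (hB : ∀ j, YoungRegular P (B j)) :
    ∃ Y : ℝ≥0 → Ω → ℝ, YoungRegular P Y ∧
      ∀ s ∈ Set.Icc a T, HasMultipleIntegral P T r B (orderedSimplex r a s) (Y s) := by
  classical
  induction r with
  | zero =>
    refine ⟨fun _ _ => 1, .of_const (.const 1), fun s _ => ?_⟩
    simp [HasMultipleIntegral, orderedSimplex, Subsingleton.monotone]
  | succ r ih =>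
    obtain ⟨Y, hY, hYint⟩ := ih (B := fun j => B j.castSucc) fun j => hB _
    obtain ⟨Z, hZ, hZint⟩ := exists_young_integral hY (hB (Fin.last r)) haT
    refine ⟨Z, hZ, fun s hs => ⟨_, fun s' _ => ?_, hZint s hs⟩⟩
    by_cases h : s' ∈ Set.Icc a s
    · rw [orderedSimplex_section h, if_pos h]
      exact hYint s' ⟨h.1, h.2.trans hs.2⟩
    · rw [cube_section_eq_empty h (orderedSimplex_subset_cube _ _ _), if_neg h]
      exact hasMultipleIntegral_empty _

lemma exists_hasMultipleIntegral_cube {a b : ℝ≥0} (hab : a ≤ b) (hb : b ≤ T) {r : ℕ}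
    {B : Fin r → ℝ≥0 → Ω → ℝ} (hB : ∀ j, YoungRegular P (B j)) :
    ∃ J, HasMultipleIntegral P T r B (cube r a b) J := by
  classical
  induction r with
  | zero => exact ⟨_, Filter.EventuallyEq.rfl⟩
  | succ r ih =>
    obtain ⟨J, hJ⟩ := ih (B := fun j => B j.castSucc) fun j => hB _
    obtain ⟨Z, -, hZint⟩ := exists_young_integral (.of_const hJ.hasAllMoments) (hB (Fin.last r))
      (hab.trans hb)
    refine ⟨Z b, _, fun s' _ => ?_, hZint b ⟨hab, hb⟩⟩
    by_cases h : s' ∈ Set.Icc a b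
    · rw [cube_section h, if_pos h]
      exact hJ
    · rw [cube_section_eq_empty h le_rfl, if_neg h]
      exact hasMultipleIntegral_empty _

/-- Gluing along a partition: for sets `S a b ⊆ [a, b]^r` that contain the corners
`(a, …, a)` and `(b, …, b)`, the integral over the union of the `S t_k t_{k+1}` exists if the
integral over every `S a b` does. For `k ≥ 1`, the union of the first `k` sets meets the next one
exactly in `S t_k t_k`, so that inclusion–exclusion applies. -/
lemma exists_hasMultipleIntegral_iUnion {r : ℕ} {B : Fin r → ℝ≥0 → Ω → ℝ}
    (hB : ∀ j t, HasAllMoments P (B j t)) {S : ℝ≥0 → ℝ≥0 → Set (Fin r → ℝ≥0)}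
    (hcube : ∀ a b, S a b ⊆ cube r a b) (hcorner : ∀ a b, a ≤ b → (fun _ => b) ∈ S a b)
    (hex : ∀ a b, a ≤ b → b ≤ T → ∃ J, HasMultipleIntegral P T r B (S a b) J)
    (hleft : ∀ a b, a ≤ b → (fun _ => a) ∈ S a b)
    {n : ℕ} {t : Fin (n + 1) → ℝ≥0} (ht : StrictMono t) (htn : t (Fin.last n) = T) :
    ∃ J, HasMultipleIntegral P T r B (⋃ k : Fin n, S (t k.castSucc) (t k.succ)) J := by
  have hle : ∀ k : Fin n, t k.castSucc ≤ t k.succ := fun k => (ht k.castSucc_lt_succ).le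
  have hT : ∀ k, t k ≤ T := fun k => (ht.monotone (Fin.le_last k)).trans_eq htn
  have key : ∀ m ≤ n, ∃ J, HasMultipleIntegral P T r B
      {x | ∃ k : Fin n, (k : ℕ) < m ∧ x ∈ S (t k.castSucc) (t k.succ)} J := by
    intro m hm
    induction m with
    | zero => exact ⟨_, by simpa using hasMultipleIntegral_empty B⟩
    | succ m ih =>
      obtain ⟨J₁, h₁⟩ := ih (by omega)
      let k₀ : Fin n := ⟨m, hm⟩
      obtain ⟨J₂, h₂⟩ := hex _ _ (hle k₀) (hT _)
      have hunion : {x | ∃ k : Fin n, (k : ℕ) < m + 1 ∧ x ∈ S (t k.castSucc) (t k.succ)}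
          = {x | ∃ k : Fin n, (k : ℕ) < m ∧ x ∈ S (t k.castSucc) (t k.succ)}
            ∪ S (t k₀.castSucc) (t k₀.succ) := by
        ext x
        constructor
        · rintro ⟨k, hk, hx⟩
          rcases Nat.lt_succ_iff_lt_or_eq.1 hk with h | h
          · exact Or.inl ⟨k, h, hx⟩
          · obtain rfl : k = k₀ := Fin.ext h
            exact Or.inr hx
        · rintro (⟨k, hk, hx⟩ | hx)
          · exact ⟨k, by omega, hx⟩
          · exact ⟨k₀, by simp [k₀], hx⟩
      have hinter : ∃ J₃, HasMultipleIntegral P T r B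
          ({x | ∃ k : Fin n, (k : ℕ) < m ∧ x ∈ S (t k.castSucc) (t k.succ)}
            ∩ S (t k₀.castSucc) (t k₀.succ)) J₃ := by
        rcases Nat.eq_zero_or_pos m with rfl | hm0
        · exact ⟨_, by simpa using hasMultipleIntegral_empty B⟩
        · obtain ⟨J₃, h₃⟩ := hex _ _ le_rfl (hT k₀.castSucc)
          refine ⟨J₃, ?_⟩
          convert h₃ using 1
          ext x
          constructor
          · rintro ⟨⟨k, hk, hx⟩, hx'⟩
            have hkk : t k.succ ≤ t k₀.castSucc := ht.monotone (by simpa [Fin.le_def, k₀] using hk)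
            have : x = fun _ => t k₀.castSucc := funext fun i =>
              le_antisymm ((hcube _ _ hx i).2.trans hkk) (hcube _ _ hx' i).1
            rw [this]
            exact hcorner _ _ le_rfl
          · intro hx
            have : x = fun _ => t k₀.castSucc := funext fun i =>
              le_antisymm (hcube _ _ hx i).2 (hcube _ _ hx i).1
            rw [this]
            let k₁ : Fin n := ⟨m - 1, by omega⟩
            have hk₁ : k₁.succ = k₀.castSucc := by
              ext; simp [k₁, k₀]; omega
            refine ⟨⟨k₁, by simp [k₁]; omega, ?_⟩, hleft _ _ (hle k₀)⟩
            rw [← hk₁]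
            exact hcorner _ _ (hle k₁)
      obtain ⟨J₃, h₃⟩ := hinter
      rw [hunion]
      exact ⟨_, h₁.union hB h₂ h₃⟩
  obtain ⟨J, hJ⟩ := key n le_rfl
  refine ⟨J, ?_⟩
  convert hJ using 1
  ext x
  simp

end MultipleExistence

/-! ### Fractional Brownian motion -/

section FBM

/-- Finitely many independent Gaussian processes form a jointly Gaussian family. -/
lemma isGaussianProcess_of_iIndepFun {Ω κ ι : Type*} [MeasurableSpace Ω]
    {P : Measure Ω} [Finite κ] {X : κ → ι → Ω → ℝ}
    (hX : ∀ k, IsGaussianProcess (X k) P)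
    (hind : iIndepFun (fun k ω i => X k i ω) P) :
    IsGaussianProcess (fun (q : κ × ι) ω => X q.1 q.2 ω) P where
  hasGaussianLaw I := by
    classical
    let K : Finset ι := I.image Prod.snd
    have h := iIndepFun.hasGaussianLaw (X := fun k ω => K.restrict (X k · ω))
      (fun k => (hX k).hasGaussianLaw K)
      (hind.comp (fun _ f => K.restrict f) fun _ => Finset.measurable_restrict K)
    let L : (κ → K → ℝ) →L[ℝ] I → ℝ :=
      ContinuousLinearMap.pi fun q => (ContinuousLinearMap.proj (R := ℝ) (φ := fun _ : K => ℝ)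
        ⟨q.1.2, Finset.mem_image_of_mem _ q.2⟩).comp (ContinuousLinearMap.proj q.1.1)
    have := Fintype.ofFinite κ
    exact h.map L

variable {Ω : Type*} [MeasurableSpace Ω] {P : Measure Ω} {H : ℝ} {B : ℝ≥0 → Ω → ℝ}

lemma IsFBM.hasAllMoments (hB : IsFBM P H B) (t : ℝ≥0) : HasAllMoments P (B t) :=
  hB.gaussian.hasAllMoments t

variable [IsProbabilityMeasure P]

lemma IsFBM.integral_increment (hB : IsFBM P H B) (u v : ℝ≥0) :
    ∫ ω, (B v ω - B u ω) ∂P = 0 := by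
  rw [integral_sub (hB.hasAllMoments v).integrable (hB.hasAllMoments u).integrable, hB.centered,
    hB.centered, sub_zero]

lemma IsFBM.covariance_increments (hB : IsFBM P H B) (u v u' v' : ℝ≥0) :
    cov[fun ω => B v ω - B u ω, fun ω => B v' ω - B u' ω; P]
      = 1 / 2 * (|(v : ℝ) - u'| ^ (2 * H) + |(u : ℝ) - v'| ^ (2 * H)
        - |(v : ℝ) - v'| ^ (2 * H) - |(u : ℝ) - u'| ^ (2 * H)) := by
  have hm := fun t => (hB.hasAllMoments t).memLp_two
  have hcov : ∀ s t, cov[B s, B t; P]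
      = 1 / 2 * ((s : ℝ) ^ (2 * H) + (t : ℝ) ^ (2 * H) - |(s : ℝ) - t| ^ (2 * H)) := fun s t => by
    rw [covariance_eq_sub (hm s) (hm t), hB.centered, zero_mul, sub_zero, ← hB.covariance]
    rfl
  change cov[B v - B u, B v' - B u'; P] = _
  rw [covariance_sub_sub (hm v) (hm u) (hm v') (hm u')]
  simp only [hcov]
  ring

/-- For `H ≥ 1/2`, increments are positively correlated, by convexity of `x ↦ |x|^{2H}`. -/
lemma IsFBM.covariance_increments_nonneg (hB : IsFBM P H B) (hH : 1 / 2 ≤ H) {u v u' v' : ℝ≥0}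
    (huv : u ≤ v) (huv' : u' ≤ v') :
    0 ≤ cov[fun ω => B v ω - B u ω, fun ω => B v' ω - B u' ω; P] := by
  rw [hB.covariance_increments]
  have hconv : ConvexOn ℝ Set.univ fun x : ℝ => |x| ^ (2 * H) := by
    have h1 : ConvexOn ℝ (Set.Ici 0) fun x : ℝ => x ^ (2 * H) := convexOn_rpow (by linarith)
    have h2 : ConvexOn ℝ Set.univ fun x : ℝ => |x| := by
      simpa using! convexOn_norm (E := ℝ) convex_univ
    have him : (fun x : ℝ => |x|) '' Set.univ ⊆ Set.Ici 0 := by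
      rintro _ ⟨x, -, rfl⟩; exact abs_nonneg x
    refine ⟨convex_univ, fun x _ y _ p q hp hq hpq => ?_⟩
    refine le_trans ?_ (h1.2 (abs_nonneg x) (abs_nonneg y) hp hq hpq)
    exact Real.rpow_le_rpow (abs_nonneg _) (h2.2 trivial trivial hp hq hpq) (by linarith)
  have c1 : (u : ℝ) ≤ v := by exact_mod_cast huv
  have c2 : (u' : ℝ) ≤ v' := by exact_mod_cast huv'
  rcases (add_nonneg (sub_nonneg.2 c1) (sub_nonneg.2 c2)).eq_or_lt with h0 | hpos
  · have e1 : (u : ℝ) = v := by linarith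
    have e2 : (u' : ℝ) = v' := by linarith
    rw [e1, e2]
    linarith
  -- `v - v'` and `u - u'` are convex combinations of `u - v'` and `v - u'` with swapped weights
  set D : ℝ := ((v : ℝ) - u) + (v' - u') with hD
  have w1 : 0 ≤ ((v : ℝ) - u) / D := div_nonneg (sub_nonneg.2 c1) hpos.le
  have w2 : 0 ≤ ((v' : ℝ) - u') / D := div_nonneg (sub_nonneg.2 c2) hpos.le
  have w : ((v : ℝ) - u) / D + ((v' : ℝ) - u') / D = 1 := by
    rw [← add_div, ← hD, div_self hpos.ne']
  have k1 := hconv.2 (Set.mem_univ ((u : ℝ) - v')) (Set.mem_univ ((v : ℝ) - u')) w2 w1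
    (by rw [add_comm, w])
  have k2 := hconv.2 (Set.mem_univ ((u : ℝ) - v')) (Set.mem_univ ((v : ℝ) - u')) w1 w2 w
  simp only [smul_eq_mul] at k1 k2
  have e1 : ((v' : ℝ) - u') / D * ((u : ℝ) - v') + ((v : ℝ) - u) / D * (v - u') = v - v' := by
    field_simp
    rw [hD]; ring
  have e2 : ((v : ℝ) - u) / D * ((u : ℝ) - v') + ((v' : ℝ) - u') / D * (v - u') = u - u' := by
    field_simp
    rw [hD]; ring
  rw [e1] at k1
  rw [e2] at k2
  have key := add_le_add k1 k2
  have e3 : ((v' : ℝ) - u') / D * |(u : ℝ) - v'| ^ (2 * H)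
      + ((v : ℝ) - u) / D * |(v : ℝ) - u'| ^ (2 * H)
      + (((v : ℝ) - u) / D * |(u : ℝ) - v'| ^ (2 * H)
        + ((v' : ℝ) - u') / D * |(v : ℝ) - u'| ^ (2 * H))
      = |(u : ℝ) - v'| ^ (2 * H) + |(v : ℝ) - u'| ^ (2 * H) := by
    linear_combination (|(u : ℝ) - v'| ^ (2 * H) + |(v : ℝ) - u'| ^ (2 * H)) * w
  linarith

/-- A fractional Brownian motion is `H`-Hölder continuous in every `L_p`, by scaling. -/
lemma IsFBM.youngRegular (hB : IsFBM P H B) (hH : 1 / 2 < H) : YoungRegular P B := by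
  refine ⟨hB.hasAllMoments, fun p hp hp' => ⟨H, (eLpNorm id p (gaussianReal 0 1)).toReal, hH,
    ENNReal.toReal_nonneg, fun u v huv => ?_⟩⟩
  have c : (0 : ℝ) ≤ (v : ℝ) - u := sub_nonneg.2 (by exact_mod_cast huv)
  have hfin : eLpNorm id p (gaussianReal 0 1) ≠ ∞ := (memLp_id_gaussianReal' p hp').2.ne
  have hX : HasGaussianLaw (fun ω => B v ω - B u ω) P := hB.gaussian.hasGaussianLaw_fun_sub
  have hvar : Var[fun ω => B v ω - B u ω; P] = (((v : ℝ) - u) ^ H) ^ 2 := by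
    rw [← covariance_self hX.aemeasurable, hB.covariance_increments, sub_self, sub_self, abs_zero,
      Real.zero_rpow (by linarith : 2 * H ≠ 0), abs_sub_comm (u : ℝ) v, abs_of_nonneg c,
      ← Real.rpow_natCast, ← Real.rpow_mul c]
    push_cast
    ring_nf
  have hlaw : P.map (fun ω => B v ω - B u ω)
      = (gaussianReal 0 1).map (fun x => ((v : ℝ) - u) ^ H * x) := by
    rw [hX.map_eq_gaussianReal, hB.integral_increment, hvar, gaussianReal_map_const_mul, mul_zero,
      mul_one]
    congr 1
    ext
    simp [Real.coe_toNNReal _ (sq_nonneg _)]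
  have e : eLpNorm (fun ω => B v ω - B u ω) p P
      = eLpNorm (((v : ℝ) - u) ^ H • (id : ℝ → ℝ)) p (gaussianReal 0 1) := by
    have h1 := eLpNorm_map_measure (p := p) (g := (id : ℝ → ℝ)) (μ := P) (by fun_prop)
      hX.aemeasurable
    rw [hlaw, eLpNorm_map_measure (by fun_prop) (by fun_prop)] at h1
    exact h1.symm
  rw [e, eLpNorm_const_smul, ← ofReal_norm, Real.norm_of_nonneg (by positivity),
    mul_comm _ (((v : ℝ) - u) ^ H), ENNReal.ofReal_mul (by positivity), ENNReal.ofReal_toReal hfin]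

lemma youngRegular_identityProcess : YoungRegular P (identityProcess Ω) := by
  refine ⟨fun s => .const _, fun p hp _ => ⟨1, 1, by norm_num, zero_le_one, fun u v huv => ?_⟩⟩
  have c : (0 : ℝ) ≤ (v : ℝ) - u := sub_nonneg.2 (by exact_mod_cast huv)
  simp only [identityProcess]
  rw [eLpNorm_const _ (by positivity) (IsProbabilityMeasure.ne_zero P)]
  simp [← ofReal_norm, abs_of_nonneg c]

lemma isGaussianProcess_identityProcess : IsGaussianProcess (identityProcess Ω) P where
  hasGaussianLaw I := by
    refine ⟨?_⟩
    have : (fun ω : Ω => I.restrict (identityProcess Ω · ω))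
        = fun _ => fun t : I => ((t : ℝ≥0) : ℝ) := rfl
    rw [this, Measure.map_const, measure_univ, one_smul]
    infer_instance

end FBM

/-! ### Integrators: independent fractional Brownian motions and the identity -/

section Integrators

variable {Ω : Type*} [MeasurableSpace Ω] {P : Measure Ω} [IsProbabilityMeasure P]

/-- The processes allowed as integrators: a fractional Brownian motion with Hurst parameter above
`1/2`, or the identity. -/
def IsIntegrator (P : Measure Ω) (B : ℝ≥0 → Ω → ℝ) : Prop :=
  (∃ H : ℝ, 1 / 2 < H ∧ IsFBM P H B) ∨ B = identityProcess Ω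

lemma IsIntegrator.youngRegular {B : ℝ≥0 → Ω → ℝ} (hB : IsIntegrator P B) : YoungRegular P B := by
  rcases hB with ⟨H, hH, hB⟩ | rfl
  · exact hB.youngRegular hH
  · exact youngRegular_identityProcess

lemma IsIntegrator.gaussian {B : ℝ≥0 → Ω → ℝ} (hB : IsIntegrator P B) :
    IsGaussianProcess B P := by
  rcases hB with ⟨H, -, hB⟩ | rfl
  · exact hB.gaussian
  · exact isGaussianProcess_identityProcess

lemma IsIntegrator.integral_increment_nonneg {B : ℝ≥0 → Ω → ℝ} (hB : IsIntegrator P B)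
    {u v : ℝ≥0} (huv : u ≤ v) : 0 ≤ ∫ ω, (B v ω - B u ω) ∂P := by
  rcases hB with ⟨H, -, hB⟩ | rfl
  · exact (hB.integral_increment u v).ge
  · exact integral_nonneg fun ω => sub_nonneg.2 (by exact_mod_cast huv)

lemma IsIntegrator.covariance_increments_nonneg {B : ℝ≥0 → Ω → ℝ} (hB : IsIntegrator P B)
    {u v u' v' : ℝ≥0} (huv : u ≤ v) (huv' : u' ≤ v') :
    0 ≤ cov[fun ω => B v ω - B u ω, fun ω => B v' ω - B u' ω; P] := by
  rcases hB with ⟨H, hH, hB⟩ | rfl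
  · exact hB.covariance_increments_nonneg hH.le huv huv'
  · exact (covariance_const_left (μ := P) ((v : ℝ) - u)).ge

variable {r : ℕ}

/-- The family of all increments of the integrators `B j` over intervals `[u, v]`. -/
def incrementFamily (B : Fin r → ℝ≥0 → Ω → ℝ) (q : Fin r × {x : ℝ≥0 × ℝ≥0 // x.1 ≤ x.2}) (ω : Ω) :
    ℝ := B q.1 q.2.1.2 ω - B q.1 q.2.1.1 ω

variable {B : Fin r → ℝ≥0 → Ω → ℝ}

lemma isGaussianProcess_incrementFamily (hB : ∀ j, IsIntegrator P (B j))
    (hind : iIndepFun (fun (X : Set.range B) (ω : Ω) (t : ℝ≥0) => X.1 t ω) P) :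
    IsGaussianProcess (incrementFamily B) P := by
  classical
  have hjoint := isGaussianProcess_of_iIndepFun (X := fun (X : Set.range B) => X.1) (P := P) (by
    rintro ⟨_, j, rfl⟩
    exact (hB j).gaussian) hind
  refine hjoint.of_isGaussianProcess fun q => ?_
  let X : Set.range B := ⟨B q.1, q.1, rfl⟩
  refine ⟨{(X, q.2.1.1), (X, q.2.1.2)}, ContinuousLinearMap.proj (R := ℝ) (φ := fun _ => ℝ)
      ⟨(X, q.2.1.2), by simp⟩ - ContinuousLinearMap.proj (R := ℝ) (φ := fun _ => ℝ)
      ⟨(X, q.2.1.1), by simp⟩, fun ω => ?_⟩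
  simp [incrementFamily, X]

lemma covariance_incrementFamily_nonneg (hB : ∀ j, IsIntegrator P (B j))
    (hind : iIndepFun (fun (X : Set.range B) (ω : Ω) (t : ℝ≥0) => X.1 t ω) P)
    (p q : Fin r × {x : ℝ≥0 × ℝ≥0 // x.1 ≤ x.2}) :
    0 ≤ cov[incrementFamily B p, incrementFamily B q; P] := by
  obtain ⟨i, ⟨u, v⟩, huv⟩ := p
  obtain ⟨j, ⟨u', v'⟩, huv'⟩ := q
  by_cases hij : B i = B j
  · have := (hB i).covariance_increments_nonneg huv huv'
    rw [hij] at this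
    change 0 ≤ cov[fun ω => B i v ω - B i u ω, fun ω => B j v' ω - B j u' ω; P]
    rwa [hij]
  · have hne : (⟨B i, i, rfl⟩ : Set.range B) ≠ ⟨B j, j, rfl⟩ := fun h => hij (congrArg (·.1) h)
    have hindep := (hind.indepFun hne).comp (φ := fun f : ℝ≥0 → ℝ => f v - f u)
      (ψ := fun f : ℝ≥0 → ℝ => f v' - f u') (by fun_prop) (by fun_prop)
    have hm := fun k s => ((hB k).youngRegular.moments s)
    exact (hindep.covariance_eq_zero ((hm i v).sub (hm i u)).memLp_two
      ((hm j v').sub (hm j u')).memLp_two).ge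

end Integrators

theorem mainTheorem5 {Ω : Type*} [MeasurableSpace Ω] (P : Measure Ω) [IsProbabilityMeasure P]
    (T : ℝ≥0) (hT : 0 < T)
    (r : ℕ) (B : Fin r → ℝ≥0 → Ω → ℝ)
    -- each `B^j` is a fractional Brownian motion with Hurst parameter `> 1/2` or the identity
    (hB : ∀ j, (∃ H : ℝ, 1 / 2 < H ∧ IsFBM P H (B j)) ∨ B j = identityProcess Ω)
    -- the distinct processes among `B^1, …, B^r` are mutually independent
    (hind : iIndepFun (fun (X : Set.range B) (ω : Ω) (t : ℝ≥0) => X.1 t ω) P)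
    -- a partition `0 = t_0 < t_1 < ⋯ < t_n = T`
    (n : ℕ) (t : Fin (n + 1) → ℝ≥0) (ht : StrictMono t) (ht0 : t 0 = 0)
    (htn : t (Fin.last n) = T)
    (A A' : Set (Fin r → ℝ≥0))
    (hA : A = ⋃ k : Fin n, orderedSimplex r (t k.castSucc) (t k.succ))
    (hA' : A' = ⋃ k : Fin n, cube r (t k.castSucc) (t k.succ)) :
    MultipleIntegralWellDefined P T r B A ∧
    MultipleIntegralWellDefined P T r B A' ∧
    ∀ J J' : Ω → ℝ, HasMultipleIntegral P T r B A J → HasMultipleIntegral P T r B A' J' →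
      MemLp J 2 P ∧ MemLp J' 2 P ∧
      ∫ ω, |J ω| ^ 2 ∂P ≤ ∫ ω, |J' ω| ^ 2 ∂P ∧
      ∫ ω, |J ω - ∫ ω', J ω' ∂P| ^ 2 ∂P ≤ ∫ ω, |J' ω - ∫ ω', J' ω' ∂P| ^ 2 ∂P := by
  have hI : ∀ j, IsIntegrator P (B j) := hB
  have hY : ∀ j, YoungRegular P (B j) := fun j => (hI j).youngRegular
  have hm : ∀ j s, HasAllMoments P (B j s) := fun j => (hY j).moments
  have hexA : ∃ J, HasMultipleIntegral P T r B A J := by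
    rw [hA]
    refine exists_hasMultipleIntegral_iUnion hm (S := orderedSimplex r)
      (orderedSimplex_subset_cube r) (fun a b hab => ⟨monotone_const, fun _ => ⟨hab, le_rfl⟩⟩)
      (fun a b hab hb => ?_) (fun a b hab => ⟨monotone_const, fun _ => ⟨le_rfl, hab⟩⟩) ht htn
    obtain ⟨Y, -, h⟩ := exists_hasMultipleIntegral_orderedSimplex (hab.trans hb) hY
    exact ⟨_, h b ⟨hab, hb⟩⟩
  have hexA' : ∃ J, HasMultipleIntegral P T r B A' J := by
    rw [hA']
    exact exists_hasMultipleIntegral_iUnion hm (S := cube r)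
      (fun _ _ => le_rfl) (fun a b hab _ => ⟨hab, le_rfl⟩)
      (fun a b hab hb => exists_hasMultipleIntegral_cube hab hb hY)
      (fun a b hab _ => ⟨le_rfl, hab⟩) ht htn
  refine ⟨⟨hexA, fun _ _ h h' => h.ae_unique hm h'⟩, ⟨hexA', fun _ _ h h' => h.ae_unique hm h'⟩,
    fun J J' hJ hJ' => ⟨hJ.hasAllMoments.memLp_two, hJ'.hasAllMoments.memLp_two, ?_⟩⟩
  have hsub : A ⊆ A' := by
    rw [hA, hA']
    exact Set.iUnion_mono fun k => orderedSimplex_subset_cube _ _ _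
  have hG := isGaussianProcess_incrementFamily hI hind
  have hS : ∀ X ∈ Set.range (incrementFamily B), HasAllMoments P X := by
    rintro _ ⟨q, rfl⟩
    exact hG.hasAllMoments q
  have hBS : ∀ j u v, u ≤ v → (fun ω => B j v ω - B j u ω) ∈ Set.range (incrementFamily B) :=
    fun j u v huv => ⟨(j, ⟨(u, v), huv⟩), rfl⟩
  exact integral_sq_le_of_mem_momentCone hG (fun q => (hI q.1).integral_increment_nonneg q.2.2)
    (covariance_incrementFamily_nonneg hI hind) (hJ.mem_momentCone hS hm hBS)
    (hJ.sub_mem_momentCone hS hm hBS hsub hJ')
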